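/- For a real number $\beta>1$ let $d_\beta(1)=t_1t_2t_3\cdots$ be the Rényi expansion of unity, $t_i=\lfloor \beta T_\beta^{i-1}(1)\rfloor$ with $T_\beta(x)=\{\beta x\}$ (fractional part). Let $\beta>1$ be a non-simple Parry number, i.e. $d_\beta(1)$ is eventually periodic but does not end in infinitely many zeros, and write $d_\beta(1)=t_1\cdots t_m(t_{m+1}\cdots t_{m+p})^\omega$ with $m,p>0$ least possible. Let $\varphi$ be the canonical substitution on $\{0,1,\dots,m+p-1\}$, given by $\varphi(k)=0^{t_{k+1}}(k+1)$ for $0\le k\le m+p-2$ and $\varphi(m+p-1)=0^{t_{m+p}}m$, and let $\mathbf u_\beta=\lim_{n\to\infty}\varphi^n(0)$ be its fixed point. A left extension of a finite word $v$ is a letter $a$ such that $av$ is a factor of $\mathbf u_\beta$; a factor $v$ of $\mathbf u_\beta$ is left special if it has at least two left extensions. An infinite word $\mathbf w$ is an infinite left special (LS) branch of $\mathbf u_\beta$ if each of its prefixes is a left special factor of $\mathbf u_\beta$; the left extensions of $\mathbf w$ are the letters that are left extensions of all its prefixes. Put $t=\min\{t_m,t_{m+p}\}$. The word $0^tm$ has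 exactly one non-zero left extension $z$; write $\beta\in\mathcal S$ if $z=sp$ for some positive integer $s$. Then: (i) If $p>1$, then $\mathbf u_\beta$ is an infinite LS branch of $\mathbf u_\beta$, and its set of left extensions is $\{m,m+1,\dots,m+p-1\}$. (ii) If $\beta\notin\mathcal S$, then $\mathbf u_\beta$ is the unique infinite LS branch of $\mathbf u_\beta$. (iii) If $\beta\in\mathcal S$, then the $m$ infinite words $$\varphi^{j}(0^tm)\,\varphi^{m+j}(0^tm)\,\varphi^{2m+j}(0^tm)\cdots,\qquad j=0,1,\dots,m-1,$$ are pairwise distinct, different from $\mathbf u_\beta$, and are infinite LS branches of $\mathbf u_\beta$. Apart from them, and from $\mathbf u_\beta$ itself in the case $p>1$, there are no other infinite LS branches of $\mathbf u_\beta$. -/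

import Mathlib

namespace ParryWord

/-! ### Infinite words, factors, left special branches -/

section Words

variable {α : Type*}

/-- The word `u_j u_{j+1} ⋯ u_{j+n-1}` of length `n` (positions are counted from `0`). -/
def subword (u : ℕ → α) (j n : ℕ) : List α :=
  (List.range n).map fun i => u (j + i)

/-- `v` is a factor of the infinite word `u`. -/
def IsFactor (u : ℕ → α) (v : List α) : Prop :=
  ∃ j, v = subword u j v.length

/-- The set of left extensions of a finite word `v` in `u`. -/
def leftExt (u : ℕ → α) (v : List α) : Set α :=
  {a | IsFactor u (a :: v)}

/-- `v` is a left special factor of `u`: a factor with at least two left extensions. -/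
def IsLeftSpecial (u : ℕ → α) (v : List α) : Prop :=
  IsFactor u v ∧ (leftExt u v).Nontrivial

/-- `w` is an infinite left special branch of `u`: every prefix of `w` is left special. -/
def IsInfLSBranch (u w : ℕ → α) : Prop :=
  ∀ n, IsLeftSpecial u (subword w 0 n)

/-- The set of left extensions of an infinite word `w` in `u`. -/
def leftExtInf (u w : ℕ → α) : Set α :=
  ⋂ n, leftExt u (subword w 0 n)

/-- The extension of a substitution to finite words. -/
def applySubst (φ : α → List α) (v : List α) : List α :=
  v.flatMap φ

/-- The `n`-th iterate of a substitution, on finite words. -/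
def iterSubst (φ : α → List α) (n : ℕ) (v : List α) : List α :=
  (applySubst φ)^[n] v

/-- The infinite word `lim φ^n(a)`. It is meant for `φ(a) = a s` with `s ≠ ε` and `φ` non-erasing;
then `φ^n(a)` is a prefix of `φ^(n+1)(a)` and has at least `n + 1` letters
(see `subword_limitWord`). -/
def limitWord (φ : α → List α) (a : α) : ℕ → α :=
  fun n => (iterSubst φ n [a]).getD n a

/-- The infinite concatenation `x_0 x_1 x_2 ⋯` of non-empty words: its `n`-th letter is read in
`x_0 x_1 ⋯ x_n`, which has at least `n + 1` letters (the default value `d` is not used then). -/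
def infConcat (d : α) (x : ℕ → List α) : ℕ → α :=
  fun n => ((List.range (n + 1)).flatMap x).getD n d

end Words

/-! ### Parry numbers -/

/-- The map `x ↦ {β x}`. -/
noncomputable def betaMap (β x : ℝ) : ℝ :=
  Int.fract (β * x)

/-- The digit `t_i`, `i ≥ 1`, of the Rényi expansion of unity `d_β(1) = t_1 t_2 t_3 ⋯`
(the index `0` is not used). -/
noncomputable def renyiDigit (β : ℝ) (i : ℕ) : ℕ :=
  ⌊β * (betaMap β)^[i - 1] 1⌋₊

/-- `d_β(1) = t_1 ⋯ t_m (t_{m+1} ⋯ t_{m+p})^ω` with `m, p > 0`. -/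
def HasPreperiodPeriod (β : ℝ) (m p : ℕ) : Prop :=
  0 < m ∧ 0 < p ∧ ∀ i, m < i → renyiDigit β (i + p) = renyiDigit β i

/-- `β > 1` is a non-simple Parry number: `d_β(1)` is eventually periodic, but does not end in
infinitely many zeros. -/
def IsNonSimpleParry (β : ℝ) : Prop :=
  1 < β ∧ (∃ m p, HasPreperiodPeriod β m p) ∧ ¬ ∃ N, ∀ i, N < i → renyiDigit β i = 0

/-- The least possible `m`. -/
noncomputable def preperiod (β : ℝ) : ℕ :=
  sInf {m | ∃ p, HasPreperiodPeriod β m p}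

/-- The least possible `p`. -/
noncomputable def period (β : ℝ) : ℕ :=
  sInf {p | ∃ m, HasPreperiodPeriod β m p}

/-- The canonical substitution `φ_β` of a non-simple Parry number over `{0, …, m + p - 1}`:
`k ↦ 0^{t_{k+1}} (k+1)` for `k < m + p - 1` and `m + p - 1 ↦ 0^{t_{m+p}} m`. Letters are natural
numbers; the values at `k ≥ m + p` are irrelevant, since such letters never arise from `0`. -/
noncomputable def canonicalSubst (β : ℝ) (k : ℕ) : List ℕ :=
  List.replicate (renyiDigit β (k + 1)) 0 ++
    [if k + 1 < preperiod β + period β then k + 1 else preperiod β]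

/-- The infinite word `u_β = lim φ_β^n(0)`. -/
noncomputable def parryWord (β : ℝ) : ℕ → ℕ :=
  limitWord (canonicalSubst β) 0

/-- The word `0^t m` with `t = min {t_m, t_{m+p}}`. -/
noncomputable def seedWord (β : ℝ) : List ℕ :=
  List.replicate
    (min (renyiDigit β (preperiod β)) (renyiDigit β (preperiod β + period β))) 0 ++ [preperiod β]

/-- The set `𝒮` of the non-simple Parry numbers for which the non-zero left extension `z` of
`0^t m` in `u_β` is a positive multiple of `p`. -/
def setS : Set ℝ :=
  {β | IsNonSimpleParry β ∧
    ∃ z ∈ leftExt (parryWord β) (seedWord β), z ≠ 0 ∧ ∃ s : ℕ, 0 < s ∧ z = s * period β}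

/-- The infinite word `φ^j(0^t m) φ^{m+j}(0^t m) φ^{2m+j}(0^t m) ⋯`. -/
noncomputable def branchWord (β : ℝ) (j : ℕ) : ℕ → ℕ :=
  infConcat 0 fun i => iterSubst (canonicalSubst β) (i * preperiod β + j) (seedWord β)

/-! ### The limit word is the fixed point -/

theorem iterSubst_succ_prefix {α : Type*} {φ : α → List α} {a : α} {s : List α}
    (ha : φ a = a :: s) (n : ℕ) :
    ∃ r, iterSubst φ (n + 1) [a] = iterSubst φ n [a] ++ r ∧ r = iterSubst φ n s := by
  have happ : ∀ n (x y : List α), iterSubst φ n (x ++ y) = iterSubst φ n x ++ iterSubst φ n y := by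
    intro n
    induction n with
    | zero => intro x y; rfl
    | succ n ih =>
      intro x y
      have h : applySubst φ (x ++ y) = applySubst φ x ++ applySubst φ y := by
        simp [applySubst]
      simp only [iterSubst, Function.iterate_succ, Function.comp] at ih ⊢
      rw [h, ih]
  refine ⟨_, ?_, rfl⟩
  rw [← happ]
  simp [iterSubst, applySubst, ha]

/-- Every `φ^n(a)` is a prefix of the limit word. -/
theorem subword_limitWord {α : Type*} {φ : α → List α} {a : α} {s : List α}
    (ha : φ a = a :: s) (hs : s ≠ []) (hφ : ∀ b, φ b ≠ []) (n : ℕ) :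
    n < (iterSubst φ n [a]).length ∧
      subword (limitWord φ a) 0 (iterSubst φ n [a]).length = iterSubst φ n [a] := by
  have hne : ∀ n, iterSubst φ n s ≠ [] := by
    intro n
    induction n with
    | zero => exact hs
    | succ n ih =>
      simp only [iterSubst, Function.iterate_succ_apply'] at ih ⊢
      obtain ⟨b, l, hb⟩ := List.exists_cons_of_ne_nil ih
      rw [hb]
      simp [applySubst, hφ b]
  have hlen : ∀ n, n < (iterSubst φ n [a]).length := by
    intro n
    induction n with
    | zero => simp [iterSubst]
    | succ n ih =>
      obtain ⟨r, hr, hr'⟩ := iterSubst_succ_prefix ha n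
      have : 0 < r.length := List.length_pos_iff.2 (hr' ▸ hne n)
      rw [hr, List.length_append]
      omega
  have hpre : ∀ k n, iterSubst φ n [a] <+: iterSubst φ (n + k) [a] := by
    intro k n
    induction k with
    | zero => exact List.prefix_rfl
    | succ k ih =>
      obtain ⟨r, hr, -⟩ := iterSubst_succ_prefix ha (n + k)
      exact ih.trans ⟨r, by rw [← hr]; rfl⟩
  refine ⟨hlen n, List.ext_getElem (by simp [subword]) ?_⟩
  intro i h1 h2
  simp only [subword, List.getElem_map, List.getElem_range, zero_add, limitWord]
  rw [List.getD_eq_getElem _ _ (hlen i)]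
  rcases le_total i n with h | h
  · obtain ⟨k, rfl⟩ := Nat.exists_eq_add_of_le h
    exact (hpre k i).getElem (hlen i)
  · obtain ⟨k, rfl⟩ := Nat.exists_eq_add_of_le h
    exact ((hpre k n).getElem h2).symm

end ParryWord

open ParryWord

/-! Write σ(k) for the last letter of φ(k). Every nonzero letter of u ends a block φ(k), so u can be
cut after nonzero letters. By compactness an infinite LS branch w has two left extensions a ≠ b
valid for all its prefixes. If both are nonzero, then w = φ(w') for a unique w' over the alphabet,
and w' has left extensions that σ maps to a and b. Repeat.

If this never stops, w = u (`eq_fixedWord`), because φ^N of every letter eventually begins with 0.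
The left extensions of u come from the same desubstitution: u is its own preimage, so 0 and then
every letter below m is excluded, while iterating σ on a letter preceding 0 reaches all of m, ...,
m+p-1.

Otherwise some preimage has left extensions 0 and z ≠ 0. Its first block, preceded by 0, lies inside
a longer block with the same last letter. This can happen only for the two letters m-1 and m+p-1,
both sent to m by σ. Hence the word is 0^t m followed by φ(y), where y has both letters as left
extensions. After m-1 further desubstitutions these become 0 and a nonzero multiple of p, which is z
because the nonzero left extension of 0^t m is unique (`leftExt_seed_unique`). So the word is 0^t m
φ^m(w'') with w'' of the same kind: p divides z and the word is `branch 0`. Consequently w =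
φ^n(`branch 0`), and n < m, since for n ≥ m the letters σ^n(0) and σ^n(z) coincide.

Conversely, if p divides z, the same step read forwards (`mem_leftExt_append_seed`) shows that 0 and
z extend `branch 0`. Of the digits only the facts in `ParryDigits` are used. -/

namespace ParryWord

/-! ### Prefixes of infinite words -/

section Prefixes

variable {α : Type*}

/-- The infinite word `u_k u_{k+1} u_{k+2} ⋯`. -/
def shiftWord (k : ℕ) (u : ℕ → α) : ℕ → α :=
  fun i => u (k + i)

/-- `v` is a prefix of the infinite word `w`. -/
def IsPrefixOf (v : List α) (w : ℕ → α) : Prop :=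
  subword w 0 v.length = v

@[simp]
theorem length_subword (u : ℕ → α) (j n : ℕ) : (subword u j n).length = n := by
  simp [subword]

theorem subword_shiftWord (u : ℕ → α) (k j n : ℕ) :
    subword (shiftWord k u) j n = subword u (k + j) n := by
  simp [subword, shiftWord, add_assoc]

theorem subword_add (u : ℕ → α) (j a b : ℕ) :
    subword u j (a + b) = subword u j a ++ subword u (j + a) b := by
  simp [subword, List.range_add, add_assoc, Function.comp_def]

theorem subword_succ (u : ℕ → α) (j n : ℕ) :
    subword u j (n + 1) = subword u j n ++ [u (j + n)] := by
  rw [subword_add]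
  simp [subword]

theorem subword_succ' (u : ℕ → α) (j n : ℕ) :
    subword u j (n + 1) = u j :: subword u (j + 1) n := by
  rw [add_comm, subword_add]
  simp [subword]

theorem subword_prefix_subword (u : ℕ → α) (j : ℕ) {a b : ℕ} (hab : a ≤ b) :
    subword u j a <+: subword u j b := by
  obtain ⟨c, rfl⟩ := Nat.exists_eq_add_of_le hab
  exact ⟨_, (subword_add u j a c).symm⟩

theorem subword_eq_iff {u w : ℕ → α} {j k n : ℕ} :
    subword u j n = subword w k n ↔ ∀ i < n, u (j + i) = w (k + i) := by
  simp [subword]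

theorem isPrefixOf_subword (w : ℕ → α) (n : ℕ) : IsPrefixOf (subword w 0 n) w := by
  simp [IsPrefixOf]

theorem isPrefixOf_append {v₁ v₂ : List α} {w : ℕ → α} :
    IsPrefixOf (v₁ ++ v₂) w ↔ IsPrefixOf v₁ w ∧ IsPrefixOf v₂ (shiftWord v₁.length w) := by
  simp only [IsPrefixOf, List.length_append, subword_shiftWord, subword_add]
  constructor
  · intro h
    simpa using List.append_inj h (by simp)
  · rintro ⟨h₁, h₂⟩
    simp only [zero_add, add_zero] at h₂ ⊢
    rw [h₁, h₂]

theorem isPrefixOf_cons {a : α} {v : List α} {w : ℕ → α} :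
    IsPrefixOf (a :: v) w ↔ w 0 = a ∧ IsPrefixOf v (shiftWord 1 w) := by
  rw [← List.singleton_append, isPrefixOf_append]
  simp [IsPrefixOf, subword]

theorem IsPrefixOf.of_prefix {v₁ v₂ : List α} {w : ℕ → α} (h : IsPrefixOf v₂ w)
    (hv : v₁ <+: v₂) : IsPrefixOf v₁ w := by
  obtain ⟨r, rfl⟩ := hv
  exact (isPrefixOf_append.1 h).1

theorem IsPrefixOf.getElem {v : List α} {w : ℕ → α} (h : IsPrefixOf v w) {i : ℕ}
    (hi : i < v.length) : v[i] = w i := by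
  have : (subword w 0 v.length)[i]'(by simpa using hi) = w i := by simp [subword]
  rw [← this]
  congr 1
  exact h.symm

theorem IsPrefixOf.prefix_of_length_le {v₁ v₂ : List α} {w : ℕ → α} (h₁ : IsPrefixOf v₁ w)
    (h₂ : IsPrefixOf v₂ w) (hl : v₁.length ≤ v₂.length) : v₁ <+: v₂ := by
  rw [← h₁, ← h₂]
  exact subword_prefix_subword _ _ hl

theorem isPrefixOf_of_forall_getElem {v : List α} {w : ℕ → α}
    (h : ∀ i (hi : i < v.length), v[i] = w i) : IsPrefixOf v w := by
  refine List.ext_getElem (by simp) fun i h₁ h₂ => ?_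
  simp [subword, h i h₂]

theorem isFactor_iff {u : ℕ → α} {v : List α} :
    IsFactor u v ↔ ∃ j, IsPrefixOf v (shiftWord j u) := by
  simp [IsFactor, IsPrefixOf, subword_shiftWord, eq_comm]

theorem isFactor_iff_infix {u : ℕ → α} {v : List α} :
    IsFactor u v ↔ ∃ n, v <:+: subword u 0 n := by
  constructor
  · rintro ⟨j, hj⟩
    refine ⟨j + v.length, subword u 0 j, [], ?_⟩
    rw [subword_add, zero_add, ← hj, List.append_nil]
  · rintro ⟨n, a, b, h⟩
    have h₁ : IsPrefixOf (a ++ v ++ b) u := h ▸ isPrefixOf_subword u n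
    exact isFactor_iff.2 ⟨_, (isPrefixOf_append.1 (isPrefixOf_append.1 h₁).1).2⟩

theorem IsFactor.of_infix {u : ℕ → α} {v v' : List α} (h : IsFactor u v') (hv : v <:+: v') :
    IsFactor u v := by
  obtain ⟨n, hn⟩ := isFactor_iff_infix.1 h
  exact isFactor_iff_infix.2 ⟨n, hv.trans hn⟩

theorem leftExt_anti {u : ℕ → α} {v v' : List α} (hv : v <+: v') :
    leftExt u v' ⊆ leftExt u v := fun a ha =>
  IsFactor.of_infix (u := u) ha (List.prefix_cons_inj a |>.2 hv).isInfix

theorem mem_leftExtInf {u w : ℕ → α} {a : α} :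
    a ∈ leftExtInf u w ↔ ∀ n, a ∈ leftExt u (subword w 0 n) := by
  simp [leftExtInf]

theorem mem_leftExtInf_of_frequently {u w : ℕ → α} {a : α}
    (h : ∀ n, ∃ v, subword w 0 n <+: v ∧ a ∈ leftExt u v) : a ∈ leftExtInf u w :=
  mem_leftExtInf.2 fun n => by
    obtain ⟨v, hv, ha⟩ := h n
    exact leftExt_anti hv ha

theorem mem_leftExt_of_mem_leftExtInf {u w : ℕ → α} {a : α} {v : List α}
    (ha : a ∈ leftExtInf u w) (hv : IsPrefixOf v w) : a ∈ leftExt u v :=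
  hv ▸ mem_leftExtInf.1 ha v.length

end Prefixes

/-! ### Compactness -/

/-- Sequential compactness of a product of finite sets: some subsequence converges, and convergence
means eventual equality on each finite set of coordinates. -/
theorem exists_limit_word {N : ℕ} (x : ℕ → ℕ → ℕ) (hx : ∀ n k, x n k ≤ N) :
    ∃ y : ℕ → ℕ, ∀ K, ∃ n, K ≤ n ∧ ∀ k < K, x n k = y k := by
  have hc : IsCompact (Set.pi Set.univ fun _ : ℕ => Set.Iic N) :=
    isCompact_univ_pi fun _ => (Set.finite_Iic N).isCompact
  obtain ⟨y, -, f, hf, hy⟩ := hc.tendsto_subseq (x := x) fun n k _ => hx n k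
  refine ⟨y, fun K => ?_⟩
  have h : ∀ k, ∀ᶠ n in Filter.atTop, x (f n) k = y k := fun k => by
    have := tendsto_pi_nhds.1 hy k
    rw [nhds_discrete, Filter.tendsto_pure] at this
    exact this
  have h' : ∀ᶠ n in Filter.atTop, ∀ k ∈ Set.Iio K, x (f n) k = y k :=
    (Filter.eventually_all_finite (Set.finite_Iio K)).2 fun k _ => h k
  obtain ⟨n, hn, hK⟩ := (h'.and (Filter.eventually_ge_atTop K)).exists
  exact ⟨f n, hK.trans (hf.id_le n), hn⟩

theorem isInfLSBranch_iff {u w : ℕ → ℕ} {N : ℕ} (hu : ∀ i, u i ≤ N) :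
    IsInfLSBranch u w ↔ (leftExtInf u w).Nontrivial := by
  constructor
  · intro h
    choose a ha b hb hab using fun n => (h n).2
    have hbound : ∀ {v : List ℕ} {c}, c ∈ leftExt u v → c ≤ N := by
      intro v c hc
      obtain ⟨j, hj⟩ := isFactor_iff.1 hc
      rw [isPrefixOf_cons] at hj
      exact hj.1 ▸ hu _
    -- The two extensions are stored in coordinates 0 and 1 of one word, so that a single
    -- subsequence stabilises both.
    obtain ⟨y, hy⟩ := exists_limit_word (N := N) (fun n k => if k = 0 then a n else b n)
      (fun n k => by split_ifs; exacts [hbound (ha n), hbound (hb n)])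
    refine ⟨y 0, mem_leftExtInf_of_frequently fun n => ?_, y 1,
      mem_leftExtInf_of_frequently fun n => ?_, ?_⟩
    · obtain ⟨k, hk, h'⟩ := hy (n + 2)
      refine ⟨_, subword_prefix_subword w 0 (by omega : n ≤ k), ?_⟩
      rw [← h' 0 (by omega)]
      exact ha k
    · obtain ⟨k, hk, h'⟩ := hy (n + 2)
      refine ⟨_, subword_prefix_subword w 0 (by omega : n ≤ k), ?_⟩
      rw [← h' 1 (by omega)]
      exact hb k
    · obtain ⟨k, hk, h'⟩ := hy 2
      rw [← h' 0 (by omega), ← h' 1 (by omega)]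
      exact hab k
  · rintro ⟨a, ha, b, hb, hab⟩ n
    rw [mem_leftExtInf] at ha hb
    exact ⟨IsFactor.of_infix (ha n) (List.suffix_cons _ _).isInfix, a, ha n, b, hb n, hab⟩

/-! ### Images of infinite words under a substitution -/

section Images

variable {α : Type*} {φ : α → List α}

theorem iterSubst_append (φ : α → List α) (n : ℕ) (x y : List α) :
    iterSubst φ n (x ++ y) = iterSubst φ n x ++ iterSubst φ n y := by
  induction n generalizing x y with
  | zero => rfl
  | succ n ih =>
    simp only [iterSubst, Function.iterate_succ_apply] at ih ⊢
    rw [← ih]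
    simp [applySubst]

theorem iterSubst_add (φ : α → List α) (a b : ℕ) (x : List α) :
    iterSubst φ (a + b) x = iterSubst φ a (iterSubst φ b x) :=
  Function.iterate_add_apply _ _ _ _

theorem iterSubst_flatMap {ι : Type*} (φ : α → List α) (n : ℕ) (l : List ι) (x : ι → List α) :
    iterSubst φ n (l.flatMap x) = l.flatMap fun i => iterSubst φ n (x i) := by
  induction l with
  | nil => exact Function.iterate_fixed (by simp [applySubst]) n
  | cons a l ih => rw [List.flatMap_cons, iterSubst_append, ih, List.flatMap_cons]

theorem iterSubst_prefix (φ : α → List α) (n : ℕ) {x y : List α} (h : x <+: y) :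
    iterSubst φ n x <+: iterSubst φ n y := by
  obtain ⟨r, rfl⟩ := h
  exact ⟨_, (iterSubst_append φ n x r).symm⟩

theorem iterSubst_infix (φ : α → List α) (n : ℕ) {x y : List α} (h : x <:+: y) :
    iterSubst φ n x <:+: iterSubst φ n y := by
  obtain ⟨r, s, rfl⟩ := h
  exact ⟨_, _, by rw [← iterSubst_append, ← iterSubst_append]⟩

theorem length_le_length_iterSubst (hφ : ∀ b, φ b ≠ []) (n : ℕ) (x : List α) :
    x.length ≤ (iterSubst φ n x).length := by
  induction n with
  | zero => rfl
  | succ n ih =>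
    refine ih.trans ?_
    simp only [iterSubst, Function.iterate_succ_apply']
    generalize (applySubst φ)^[n] x = y
    induction y with
    | nil => simp [applySubst]
    | cons a y ihy =>
      have := List.length_pos_iff.2 (hφ a)
      simp only [applySubst, List.flatMap_cons, List.length_append, List.length_cons] at ihy ⊢
      omega

/-- The infinite word `v` is `φ^n(w)`. -/
def IsImage (φ : α → List α) (n : ℕ) (w v : ℕ → α) : Prop :=
  ∀ k, IsPrefixOf (iterSubst φ n (subword w 0 k)) v

theorem isImage_zero (w : ℕ → α) : IsImage φ 0 w w :=
  isPrefixOf_subword w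

theorem IsImage.isPrefixOf {n : ℕ} {w v : ℕ → α} (h : IsImage φ n w v) {x : List α}
    (hx : IsPrefixOf x w) : IsPrefixOf (iterSubst φ n x) v :=
  hx ▸ h x.length

theorem IsImage.trans {a b : ℕ} {w v x : ℕ → α} (h₁ : IsImage φ a w v) (h₂ : IsImage φ b v x) :
    IsImage φ (a + b) w x := fun k => by
  rw [add_comm, iterSubst_add]
  exact h₂.isPrefixOf (h₁ k)

theorem IsImage.unique (hφ : ∀ b, φ b ≠ []) {n : ℕ} {w v v' : ℕ → α} (h : IsImage φ n w v)
    (h' : IsImage φ n w v') : v = v' := by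
  funext i
  have hi : i < (iterSubst φ n (subword w 0 (i + 1))).length :=
    lt_of_lt_of_le (by simp) (length_le_length_iterSubst hφ n _)
  rw [← (h (i + 1)).getElem hi, (h' (i + 1)).getElem hi]

theorem IsImage.shiftWord {n : ℕ} {w v : ℕ → α} (h : IsImage φ n w v) (k : ℕ) :
    IsImage φ n (shiftWord k w) (shiftWord (iterSubst φ n (subword w 0 k)).length v) := fun i => by
  have := h (k + i)
  rw [subword_add, iterSubst_append, isPrefixOf_append] at this
  rw [subword_shiftWord, ← zero_add (k + 0), add_zero]
  exact this.2

theorem isFactor_iterSubst {u : ℕ → α} {n : ℕ} (hu : IsImage φ n u u) {v : List α}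
    (hv : IsFactor u v) : IsFactor u (iterSubst φ n v) := by
  obtain ⟨k, hk⟩ := isFactor_iff_infix.1 hv
  have h : iterSubst φ n v <:+: subword u 0 (iterSubst φ n (subword u 0 k)).length :=
    (hu k).symm ▸ iterSubst_infix φ n hk
  exact isFactor_iff_infix.2 ⟨_, h⟩

theorem isImage_self_iterate {u : ℕ → α} (hu : IsImage φ 1 u u) (n : ℕ) : IsImage φ n u u := by
  induction n with
  | zero => exact isImage_zero u
  | succ n ih => exact ih.trans hu

/-! ### Infinite concatenations -/

theorem length_flatMap_range {x : ℕ → List α} (hx : ∀ i, x i ≠ []) (n : ℕ) :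
    n ≤ ((List.range n).flatMap x).length := by
  induction n with
  | zero => simp
  | succ n ih =>
    have := List.length_pos_iff.2 (hx n)
    simp only [List.range_succ, List.flatMap_append, List.length_append, List.flatMap_cons,
      List.flatMap_nil, List.append_nil]
    omega

theorem flatMap_range_prefix (x : ℕ → List α) {a b : ℕ} (h : a ≤ b) :
    (List.range a).flatMap x <+: (List.range b).flatMap x := by
  obtain ⟨c, rfl⟩ := Nat.exists_eq_add_of_le h
  rw [List.range_add, List.flatMap_append]
  exact List.prefix_append _ _

theorem isPrefixOf_infConcat (d : α) {x : ℕ → List α} (hx : ∀ i, x i ≠ []) (n : ℕ) :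
    IsPrefixOf ((List.range n).flatMap x) (infConcat d x) := by
  refine isPrefixOf_of_forall_getElem fun i hi => ?_
  have hi' : i < ((List.range (i + 1)).flatMap x).length := length_flatMap_range hx (i + 1)
  rw [infConcat, List.getD_eq_getElem _ _ hi']
  rcases le_total (i + 1) n with h | h
  · exact ((flatMap_range_prefix x h).getElem hi').symm
  · exact (flatMap_range_prefix x h).getElem hi

theorem subword_infConcat_prefix (d : α) {x : ℕ → List α} (hx : ∀ i, x i ≠ []) (n : ℕ) :
    subword (infConcat d x) 0 n <+: (List.range n).flatMap x :=
  (isPrefixOf_subword _ n).prefix_of_length_le (isPrefixOf_infConcat d hx n)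
    (by simpa using length_flatMap_range hx n)

theorem eq_infConcat (d : α) {x : ℕ → List α} (hx : ∀ i, x i ≠ []) {w : ℕ → α}
    (hw : ∀ n, IsPrefixOf ((List.range n).flatMap x) w) : w = infConcat d x := by
  funext i
  have hi : i < ((List.range (i + 1)).flatMap x).length := length_flatMap_range hx (i + 1)
  rw [← (hw (i + 1)).getElem hi, (isPrefixOf_infConcat d hx (i + 1)).getElem hi]

theorem iterSubst_ne_nil (hφ : ∀ b, φ b ≠ []) (n : ℕ) {x : List α} (hx : x ≠ []) :
    iterSubst φ n x ≠ [] :=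
  List.length_pos_iff.1 ((List.length_pos_iff.2 hx).trans_le (length_le_length_iterSubst hφ n x))

theorem isImage_infConcat (d : α) (hφ : ∀ b, φ b ≠ []) (n : ℕ) {x : ℕ → List α}
    (hx : ∀ i, x i ≠ []) :
    IsImage φ n (infConcat d x) (infConcat d fun i => iterSubst φ n (x i)) := fun k => by
  refine IsPrefixOf.of_prefix ?_ (iterSubst_prefix φ n (subword_infConcat_prefix d hx k))
  rw [iterSubst_flatMap]
  exact isPrefixOf_infConcat d (fun i => iterSubst_ne_nil hφ n (hx i)) k

theorem isImage_limitWord {a : α} {s : List α} (ha : φ a = a :: s) (hs : s ≠ [])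
    (hφ : ∀ b, φ b ≠ []) : IsImage φ 1 (limitWord φ a) (limitWord φ a) := fun k => by
  have h := fun n => subword_limitWord ha hs hφ n
  have hp : subword (limitWord φ a) 0 k <+: iterSubst φ k [a] :=
    (isPrefixOf_subword _ k).prefix_of_length_le (h k).2 (by simpa using (h k).1.le)
  refine IsPrefixOf.of_prefix ?_ (iterSubst_prefix φ 1 hp)
  rw [← iterSubst_add]
  exact (h (1 + k)).2

end Images

end ParryWord

namespace ParryWord

/-! ### The canonical substitution of an eventually periodic sequence of digits -/

/-- The last letter of the image of the letter `k` under the canonical substitution. -/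
def nextLetter (m p k : ℕ) : ℕ :=
  if k + 1 < m + p then k + 1 else m

/-- The canonical substitution of a sequence `t_1 ⋯ t_m (t_{m+1} ⋯ t_{m+p})^ω`. -/
def parrySubst (t : ℕ → ℕ) (m p k : ℕ) : List ℕ :=
  List.replicate (t (k + 1)) 0 ++ [nextLetter m p k]

/-- The properties of the Rényi expansion of unity that control the infinite left special
branches. -/
structure ParryDigits (t : ℕ → ℕ) (m p : ℕ) : Prop where
  m_pos : 0 < m
  p_pos : 0 < p
  ne : t m ≠ t (m + p)
  le : ∀ i, 0 < i → t i ≤ t 1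
  pos : 0 < t 1
  exists_pos : ∃ i, m ≤ i ∧ i < m + p ∧ 0 < t (i + 1)

/-! ### The dynamics of the last-letter map -/

section NextLetter

variable {m p : ℕ}

theorem nextLetter_pos (hm : 0 < m) (k : ℕ) : 0 < nextLetter m p k := by
  unfold nextLetter; split_ifs <;> omega

theorem nextLetter_lt (hp : 0 < p) (k : ℕ) : nextLetter m p k < m + p := by
  unfold nextLetter; split_ifs <;> omega

theorem nextLetter_of_lt {k : ℕ} (h : k + 1 < m + p) : nextLetter m p k = k + 1 :=
  if_pos h

theorem nextLetter_eq_nextLetter {a b : ℕ} (ha : a < m + p) (hb : b < m + p)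
    (h : nextLetter m p a = nextLetter m p b) :
    a = b ∨ (nextLetter m p a = m ∧
      ((a + 1 = m ∧ b + 1 = m + p) ∨ (a + 1 = m + p ∧ b + 1 = m))) := by
  unfold nextLetter at *; split_ifs at * <;> omega

theorem nextLetter_eq_of_ne {a k : ℕ} (ha : a < m + p) (hk : k ≠ m)
    (h : nextLetter m p a = k) : a + 1 = k := by
  unfold nextLetter at h; split_ifs at h <;> omega

theorem nextLetter_eq_iff_m {a : ℕ} (ha : a < m + p) :
    nextLetter m p a = m ↔ a + 1 = m ∨ a + 1 = m + p := by
  unfold nextLetter; split_ifs <;> omega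

theorem nextLetter_modEq {k : ℕ} (hk : k < m + p) : nextLetter m p k ≡ k + 1 [MOD p] := by
  unfold nextLetter
  split_ifs with h
  · rfl
  · rw [show k + 1 = m + p by omega]
    simp [Nat.ModEq]

theorem iterate_nextLetter_lt (hp : 0 < p) {k : ℕ} (hk : k < m + p) (n : ℕ) :
    (nextLetter m p)^[n] k < m + p := by
  cases n with
  | zero => exact hk
  | succ n => rw [Function.iterate_succ_apply']; exact nextLetter_lt hp _

theorem iterate_nextLetter_modEq (hp : 0 < p) {k : ℕ} (hk : k < m + p) (n : ℕ) :
    (nextLetter m p)^[n] k ≡ k + n [MOD p] := by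
  induction n with
  | zero => rfl
  | succ n ih =>
    rw [Function.iterate_succ_apply']
    exact (nextLetter_modEq (iterate_nextLetter_lt hp hk n)).trans (ih.add_right 1)

theorem iterate_nextLetter_of_lt {k n : ℕ} (h : k + n < m + p) :
    (nextLetter m p)^[n] k = k + n := by
  induction n with
  | zero => rfl
  | succ n ih =>
    rw [Function.iterate_succ_apply', ih (by omega), nextLetter_of_lt (by omega)]
    rfl

theorem le_iterate_nextLetter (hp : 0 < p) {k n : ℕ} (h : m ≤ k + n) :
    m ≤ (nextLetter m p)^[n] k := by
  induction n with
  | zero => exact h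
  | succ n ih =>
    rcases lt_or_ge (k + n + 1) (m + p) with h' | h'
    · rw [iterate_nextLetter_of_lt (n := n + 1) h']; exact h
    · have := ih (by omega)
      rw [Function.iterate_succ_apply']
      generalize (nextLetter m p)^[n] k = x at this
      unfold nextLetter; split_ifs <;> omega

/-- The map raises residues modulo p by one and never leaves {m, ..., m+p-1} once there; on that
range the residue determines the letter. -/
theorem iterate_nextLetter_eq (hp : 0 < p) {k b n : ℕ} (hk : k < m + p) (hb : m ≤ b)
    (hb' : b < m + p) (h : m ≤ k + n) (hmod : k + n ≡ b [MOD p]) :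
    (nextLetter m p)^[n] k = b := by
  have h₁ := le_iterate_nextLetter hp h
  have h₂ := iterate_nextLetter_lt hp hk n
  have h₃ := (iterate_nextLetter_modEq hp hk n).trans hmod
  obtain ⟨c, hc⟩ := Nat.exists_eq_add_of_le h₁
  obtain ⟨d, hd⟩ := Nat.exists_eq_add_of_le hb
  rw [hc, hd] at h₃
  have := Nat.ModEq.eq_of_lt_of_lt (Nat.ModEq.add_left_cancel' m h₃) (by omega) (by omega)
  omega

end NextLetter

/-! ### The fixed point and its decomposition into blocks -/

namespace ParryDigits

variable {t : ℕ → ℕ} {m p : ℕ} (h : ParryDigits t m p)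

theorem subst_ne_nil (b : ℕ) : parrySubst t m p b ≠ [] := by
  simp [parrySubst]

theorem length_subst (k : ℕ) : (parrySubst t m p k).length = t (k + 1) + 1 := by
  simp [parrySubst]

theorem iterSubst_one_singleton (k : ℕ) :
    iterSubst (parrySubst t m p) 1 [k] = parrySubst t m p k := by
  simp [iterSubst, applySubst]

theorem isPrefixOf_subst {k : ℕ} {w : ℕ → ℕ} :
    IsPrefixOf (parrySubst t m p k) w ↔
      (∀ i < t (k + 1), w i = 0) ∧ w (t (k + 1)) = nextLetter m p k := by
  rw [parrySubst, isPrefixOf_append]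
  simp [IsPrefixOf, subword, List.eq_replicate_iff, shiftWord]

variable (t m p) in
/-- The fixed point of the canonical substitution. -/
def fixedWord : ℕ → ℕ :=
  limitWord (parrySubst t m p) 0

local notation "φ" => parrySubst t m p
local notation "σ" => nextLetter m p
local notation "u" => fixedWord t m p

theorem fixedWord_zero : u 0 = 0 := rfl

/-- The image of the prefix of length `i` is followed by the image of `u_i`. -/
theorem isPrefixOf_block {n : ℕ} {w v : ℕ → ℕ} (hw : IsImage φ n w v) (i : ℕ) :
    IsPrefixOf (iterSubst φ n [w i]) (shiftWord (iterSubst φ n (subword w 0 i)).length v) := by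
  have := hw.shiftWord i 1
  rwa [subword_shiftWord, add_zero] at this

theorem length_image_succ (i : ℕ) : (iterSubst φ 1 (subword u 0 (i + 1))).length =
    (iterSubst φ 1 (subword u 0 i)).length + (t (u i + 1) + 1) := by
  rw [subword_succ, iterSubst_append, List.length_append, zero_add, iterSubst_one_singleton,
    length_subst]

theorem exists_block (j : ℕ) : ∃ i x, x ≤ t (u i + 1) ∧
    j = (iterSubst φ 1 (subword u 0 i)).length + x := by
  induction j with
  | zero => exact ⟨0, 0, Nat.zero_le _, by simp [subword, iterSubst, applySubst]⟩
  | succ j ih =>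
    obtain ⟨i, x, hx, hj⟩ := ih
    rcases hx.lt_or_eq with h' | h'
    · exact ⟨i, x + 1, h', by omega⟩
    · exact ⟨i + 1, 0, Nat.zero_le _, by rw [length_image_succ]; omega⟩

include h

theorem subst_zero_eq : ∃ s, φ 0 = 0 :: s ∧ s ≠ [] := by
  obtain ⟨k, hk⟩ := Nat.exists_eq_succ_of_ne_zero h.pos.ne'
  exact ⟨List.replicate k 0 ++ [σ 0], by simp [parrySubst, hk, List.replicate_succ], by simp⟩

theorem isImage_one : IsImage φ 1 u u := by
  obtain ⟨s, hs, hs'⟩ := h.subst_zero_eq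
  exact isImage_limitWord hs hs' subst_ne_nil

theorem isImage_self (n : ℕ) : IsImage φ n u u :=
  isImage_self_iterate h.isImage_one n

theorem isPrefixOf_iterSubst_zero (n : ℕ) :
    n < (iterSubst φ n [0]).length ∧ IsPrefixOf (iterSubst φ n [0]) u := by
  obtain ⟨s, hs, hs'⟩ := h.subst_zero_eq
  exact subword_limitWord hs hs' subst_ne_nil n

theorem fixedWord_lt (i : ℕ) : u i < m + p := by
  have hmem : u i ∈ applySubst φ (subword u 0 (i + 1)) := by
    have hi : i < (iterSubst φ 1 (subword u 0 (i + 1))).length :=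
      lt_of_lt_of_le (by simp) (length_le_length_iterSubst subst_ne_nil 1 _)
    rw [← (h.isImage_one (i + 1)).getElem hi]
    exact List.getElem_mem hi
  obtain ⟨a, -, ha⟩ := List.mem_flatMap.1 hmem
  have := h.m_pos
  have := nextLetter_lt (m := m) h.p_pos a
  simp only [parrySubst, List.mem_append, List.mem_replicate, List.mem_singleton] at ha
  omega

theorem lt_of_mem_of_isFactor {v : List ℕ} (hv : IsFactor u v) {a : ℕ} (ha : a ∈ v) :
    a < m + p := by
  rw [hv.choose_spec] at ha
  simp only [subword, List.mem_map] at ha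
  obtain ⟨i, -, rfl⟩ := ha
  exact h.fixedWord_lt _

theorem lt_of_mem_leftExtInf {w : ℕ → ℕ} {a : ℕ} (ha : a ∈ leftExtInf u w) : a < m + p :=
  h.lt_of_mem_of_isFactor (mem_leftExtInf.1 ha 0) (by simp)

theorem letter_lt_of_mem_leftExtInf {w : ℕ → ℕ} {a : ℕ} (ha : a ∈ leftExtInf u w) (i : ℕ) :
    w i < m + p :=
  h.lt_of_mem_of_isFactor (mem_leftExtInf.1 ha (i + 1)) (by simp [subword_succ])

/-- The first nonzero letter of `v` determines the first letter of `w` where `v = φ(w)`. -/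
theorem subst_prefix_unique {a b : ℕ} (ha : a < m + p) (hb : b < m + p) {v : ℕ → ℕ}
    (hav : IsPrefixOf (φ a) v) (hbv : IsPrefixOf (φ b) v) : a = b := by
  rw [isPrefixOf_subst] at hav hbv
  have h₁ := nextLetter_pos (p := p) h.m_pos a
  have h₂ := nextLetter_pos (p := p) h.m_pos b
  have hlen : t (a + 1) = t (b + 1) := by
    rcases lt_trichotomy (t (a + 1)) (t (b + 1)) with h' | h' | h'
    · have := hbv.1 _ h'; omega
    · exact h'
    · have := hav.1 _ h'; omega
  -- Only m is the last letter of two different images, and these have different lengths because t_m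
  -- ≠ t_{m+p}.
  rcases nextLetter_eq_nextLetter ha hb (by rw [← hav.2, ← hbv.2, hlen]) with h' | ⟨-, h' | h'⟩
  · exact h'
  · exact absurd hlen (by rw [h'.1, h'.2]; exact h.ne)
  · exact absurd hlen (by rw [h'.1, h'.2]; exact h.ne.symm)

theorem isImage_injective {w w' v : ℕ → ℕ} (hw : ∀ i, w i < m + p) (hw' : ∀ i, w' i < m + p)
    (hv : IsImage φ 1 w v) (hv' : IsImage φ 1 w' v) : w = w' := by
  have key : ∀ n, subword w 0 n = subword w' 0 n := by
    intro n
    induction n with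
    | zero => rfl
    | succ n ih =>
      have h₁ := isPrefixOf_block hv n
      have h₂ := isPrefixOf_block hv' n
      rw [← ih, iterSubst_one_singleton] at h₂
      rw [iterSubst_one_singleton] at h₁
      rw [subword_succ, subword_succ, ih, zero_add, h.subst_prefix_unique (hw n) (hw' n) h₁ h₂]
  funext i
  simpa using subword_eq_iff.1 (key (i + 1)) i (by omega)

/-! ### Desubstitution -/

theorem block_spec (i : ℕ) :
    (∀ x < t (u i + 1), u ((iterSubst φ 1 (subword u 0 i)).length + x) = 0) ∧
      u ((iterSubst φ 1 (subword u 0 i)).length + t (u i + 1)) = σ (u i) := by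
  have := isPrefixOf_block h.isImage_one i
  rw [iterSubst_one_singleton, isPrefixOf_subst] at this
  exact this

theorem exists_block_end {j r a : ℕ} (ha : a ≠ 0)
    (hj : IsPrefixOf (List.replicate r 0 ++ [a]) (shiftWord j u)) :
    ∃ i, (iterSubst φ 1 (subword u 0 (i + 1))).length = j + (r + 1) ∧ σ (u i) = a ∧
      r ≤ t (u i + 1) := by
  have hz : (∀ x < r, u (j + x) = 0) ∧ u (j + r) = a := by
    rw [isPrefixOf_append] at hj
    simpa [IsPrefixOf, subword, List.eq_replicate_iff, shiftWord] using hj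
  obtain ⟨i, x, hx, hjx⟩ := exists_block (j + r)
  obtain ⟨h₁, h₂⟩ := h.block_spec i
  have hxt : x = t (u i + 1) := by
    by_contra hne
    exact ha (by rw [← hz.2, hjx, h₁ x (by omega)])
  subst hxt
  refine ⟨i, by rw [length_image_succ]; omega, by rw [← h₂, ← hjx, hz.2], ?_⟩
  -- A longer run of zeros would contain the last letter of the preceding block, which is nonzero;
  -- and before the first block there is no room for it.
  by_contra! hlt
  obtain ⟨k, rfl⟩ : ∃ k, i = k + 1 := by
    refine Nat.exists_eq_succ_of_ne_zero ?_
    rintro rfl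
    simp only [subword, List.range_zero, List.map_nil, iterSubst, Function.iterate_one, applySubst,
      List.flatMap_nil, List.length_nil] at hjx
    omega
  have h₃ := (h.block_spec k).2
  rw [length_image_succ] at hjx
  have h₄ := hz.1 ((iterSubst φ 1 (subword u 0 k)).length + t (u k + 1) - j) (by omega)
  rw [show j + ((iterSubst φ 1 (subword u 0 k)).length + t (u k + 1) - j) =
    (iterSubst φ 1 (subword u 0 k)).length + t (u k + 1) by omega, h₃] at h₄
  exact (nextLetter_pos h.m_pos _).ne' h₄

/-- An infinite word all of whose prefixes occur after `0^r a` is the image of an infinite word. -/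
theorem exists_preimage {w : ℕ → ℕ} {r a : ℕ} (ha : a ≠ 0)
    (hw : ∀ n, IsFactor u (List.replicate r 0 ++ a :: subword w 0 n)) :
    ∃ b w', b ∈ leftExtInf u w' ∧ σ b = a ∧ r ≤ t (b + 1) ∧ IsImage φ 1 w' w := by
  have key : ∀ n, ∃ i, σ (u i) = a ∧ r ≤ t (u i + 1) ∧
      IsPrefixOf (subword w 0 n) (shiftWord (iterSubst φ 1 (subword u 0 (i + 1))).length u) := by
    intro n
    obtain ⟨j, hj⟩ := isFactor_iff.1 (hw n)
    rw [← List.singleton_append, ← List.append_assoc, isPrefixOf_append] at hj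
    obtain ⟨i, hi, hi', hi''⟩ := h.exists_block_end ha hj.1
    refine ⟨i, hi', hi'', ?_⟩
    convert hj.2 using 1
    funext x
    simp only [shiftWord, hi, List.length_append, List.length_replicate, List.length_singleton]
    congr 1
    omega
  -- The tails of u starting at the letters u_{i n} subconverge to y: `y 0` is the left extension
  -- sought and the rest of y is the preimage.
  choose i hi hi' hi'' using key
  obtain ⟨y, hy⟩ := exists_limit_word (N := m + p) (fun n k => u (i n + k))
    fun n k => (h.fixedWord_lt _).le
  have hy0 : ∃ n, u (i n) = y 0 := by
    obtain ⟨n, -, hn⟩ := hy 1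
    exact ⟨n, hn 0 one_pos⟩
  obtain ⟨n₀, hn₀⟩ := hy0
  refine ⟨y 0, shiftWord 1 y, mem_leftExtInf.2 fun n => ?_, hn₀ ▸ hi n₀, hn₀ ▸ hi' n₀, fun k => ?_⟩
  · obtain ⟨N, -, hN⟩ := hy (n + 1)
    rw [subword_shiftWord, add_zero, ← zero_add 1, leftExt, Set.mem_ofPred_eq, ← subword_succ']
    refine ⟨i N, ?_⟩
    rw [length_subword, subword_eq_iff]
    intro x hx
    rw [zero_add, hN x hx]
  · set l := (iterSubst φ 1 (subword (shiftWord 1 y) 0 k)).length with hl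
    -- N is large enough that the image of the prefix of length k fits into the known prefix of w of
    -- length N.
    obtain ⟨N, hlN, hN⟩ := hy (l + k + 1)
    have hsub : subword (shiftWord 1 y) 0 k = subword (shiftWord (i N + 1) u) 0 k := by
      rw [subword_shiftWord, subword_shiftWord, subword_eq_iff]
      intro x hx
      rw [← hN _ (by omega)]
      congr 1
      omega
    have h₁ := h.isImage_one.shiftWord (i N + 1) k
    rw [← hsub] at h₁
    have h₂ := h₁.prefix_of_length_le (hi'' N) (by rw [length_subword, ← hl]; omega)
    exact (isPrefixOf_subword w N).of_prefix h₂

theorem exists_preimage_of_mem {w : ℕ → ℕ} {a : ℕ} (ha : a ≠ 0) (hw : a ∈ leftExtInf u w) :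
    ∃ b w', b ∈ leftExtInf u w' ∧ σ b = a ∧ IsImage φ 1 w' w := by
  obtain ⟨b, w', h₁, h₂, -, h₃⟩ := h.exists_preimage (r := 0) ha (mem_leftExtInf.1 hw)
  exact ⟨b, w', h₁, h₂, h₃⟩

/-- Since x ends a block, the run of zeros after it starts the next one, so 0^r k is a complete
image and the length of the run is exact. -/
theorem exists_preimage_of_factor {v : List ℕ} {x r k : ℕ} (hx : x ≠ 0) (hk : k ≠ 0)
    (hv : IsFactor u (x :: (List.replicate r 0 ++ k :: v))) :
    ∃ y d, y ∈ leftExt u [d] ∧ σ y = x ∧ σ d = k ∧ t (d + 1) = r := by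
  obtain ⟨j, hj⟩ := isFactor_iff.1 hv
  rw [← List.singleton_append, isPrefixOf_append] at hj
  obtain ⟨i, hi, hi', -⟩ := h.exists_block_end (r := 0) hx hj.1
  have h₁ := hj.2.of_prefix (v₁ := List.replicate r 0 ++ [k]) ⟨v, by simp⟩
  obtain ⟨h₂, h₃⟩ := h.block_spec (i + 1)
  rw [hi] at h₂ h₃
  have hz : (∀ x < r, u (j + 1 + x) = 0) ∧ u (j + 1 + r) = k := by
    rw [isPrefixOf_append] at h₁
    simpa [IsPrefixOf, subword, List.eq_replicate_iff, shiftWord, add_assoc] using h₁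
  simp only [zero_add] at h₂ h₃
  have hr : t (u (i + 1) + 1) = r := by
    rcases lt_trichotomy (t (u (i + 1) + 1)) r with h' | h' | h'
    · exact absurd (h₃ ▸ hz.1 _ h') (nextLetter_pos h.m_pos _).ne'
    · exact h'
    · exact absurd (hz.2 ▸ h₂ _ h') hk
  refine ⟨u i, u (i + 1), ⟨i, by simp [subword, List.range_succ]⟩, hi', ?_, hr⟩
  rw [← h₃, hr, hz.2]

theorem exists_block_of_factor {r k : ℕ} (hk : k ≠ 0)
    (hv : IsFactor u (List.replicate r 0 ++ [k])) :
    ∃ d, d < m + p ∧ σ d = k ∧ r ≤ t (d + 1) := by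
  obtain ⟨j, hj⟩ := isFactor_iff.1 hv
  obtain ⟨i, -, hi, hi'⟩ := h.exists_block_end hk hj
  exact ⟨u i, h.fixedWord_lt i, hi, hi'⟩

end ParryDigits

end ParryWord

namespace ParryWord

namespace ParryDigits

variable {t : ℕ → ℕ} {m p : ℕ} (h : ParryDigits t m p)

local notation "φ" => parrySubst t m p
local notation "σ" => nextLetter m p
local notation "u" => fixedWord t m p

variable (t m p) in
/-- The word `0^t m` with `t = min {t_m, t_{m+p}}`. -/
def seed : List ℕ :=
  List.replicate (min (t m) (t (m + p))) 0 ++ [m]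

/-! ### Images of left extensions -/

theorem iterSubst_singleton_suffix (n a : ℕ) : [σ^[n] a] <:+ iterSubst φ n [a] := by
  induction n with
  | zero => exact List.suffix_rfl
  | succ n ih =>
    obtain ⟨r, hr⟩ := ih
    refine ⟨iterSubst φ 1 r ++ List.replicate (t (σ^[n] a + 1)) 0, ?_⟩
    rw [add_comm n 1, iterSubst_add, ← hr, iterSubst_append, iterSubst_one_singleton, parrySubst,
      Function.iterate_add_apply, List.append_assoc]
    rfl

/-- Every occurrence of a word that does not start with `0` has a left extension. -/
theorem exists_mem_leftExt {v : List ℕ} {k : ℕ} (hk : k ≠ 0) (hv : IsFactor u (k :: v)) :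
    ∃ y, y ∈ leftExt u (k :: v) := by
  obtain ⟨j, hj⟩ := isFactor_iff.1 hv
  obtain ⟨i, rfl⟩ : ∃ i, j = i + 1 := by
    refine Nat.exists_eq_succ_of_ne_zero ?_
    rintro rfl
    exact hk (isPrefixOf_cons.1 hj).1.symm
  refine ⟨u i, isFactor_iff.2 ⟨i, isPrefixOf_cons.2 ⟨rfl, ?_⟩⟩⟩
  convert hj using 1
  funext x
  simp [shiftWord, add_assoc]

include h

/-- The image of av under φ^n has, just before φ^n(v), the last letter of φ^n(a). -/
theorem iterate_mem_leftExt {v : List ℕ} {a : ℕ} (ha : a ∈ leftExt u v) (n : ℕ) :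
    σ^[n] a ∈ leftExt u (iterSubst φ n v) := by
  have h₁ := isFactor_iterSubst (h.isImage_self n) ha
  rw [← List.singleton_append, iterSubst_append] at h₁
  obtain ⟨r, hr⟩ := iterSubst_singleton_suffix (t := t) (m := m) (p := p) n a
  exact h₁.of_infix ⟨r, [], by rw [← hr]; simp⟩

theorem iterate_mem_leftExtInf {w v : ℕ → ℕ} {n a : ℕ} (ha : a ∈ leftExtInf u w)
    (hv : IsImage φ n w v) : σ^[n] a ∈ leftExtInf u v := by
  refine mem_leftExtInf_of_frequently fun k => ⟨iterSubst φ n (subword w 0 k), ?_,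
    h.iterate_mem_leftExt (mem_leftExtInf.1 ha k) n⟩
  refine (isPrefixOf_subword v k).prefix_of_length_le (hv k) ?_
  rw [length_subword]
  simpa using length_le_length_iterSubst (subst_ne_nil (t := t) (m := m) (p := p)) n
    (subword w 0 k)

/-! ### Left extensions of letters -/

theorem exists_eq_letter {k : ℕ} (hk : k < m + p) : ∃ i, u i = k := by
  induction k with
  | zero => exact ⟨0, fixedWord_zero⟩
  | succ k ih =>
    obtain ⟨i, hi⟩ := ih (by omega)
    exact ⟨_, by rw [(h.block_spec i).2, hi, nextLetter_of_lt hk]⟩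

/-- A letter k+1 ≠ m arises only at the end of φ(k). It is preceded by a zero of that block or, when
the block is the single letter k+1, by the end of the block before. -/
theorem mem_leftExt_singleton_succ {x k : ℕ} (hx : x ∈ leftExt u [k + 1]) (hk : k + 1 ≠ m) :
    (0 < t (k + 1) ∧ x = 0) ∨ (t (k + 1) = 0 ∧ ∃ y ∈ leftExt u [k], σ y = x) := by
  rcases eq_or_ne x 0 with rfl | hx0
  · obtain ⟨d, hd, hd', hd''⟩ := h.exists_block_of_factor (r := 1) (Nat.succ_ne_zero k) hx
    obtain rfl : d = k := by have := nextLetter_eq_of_ne hd hk hd'; omega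
    exact Or.inl ⟨hd'', rfl⟩
  · obtain ⟨y, d, hy, hyx, hd, ht⟩ :=
      h.exists_preimage_of_factor (r := 0) (v := []) hx0 (Nat.succ_ne_zero k) hx
    have hdlt : d < m + p := h.lt_of_mem_of_isFactor hy (by simp)
    obtain rfl : d = k := by have := nextLetter_eq_of_ne hdlt hk hd; omega
    exact Or.inr ⟨ht, y, hy, hyx⟩

theorem leftExt_singleton_subsingleton {k₀ k : ℕ} (h₀ : (leftExt u [k₀]).Subsingleton)
    (hle : k₀ ≤ k) (hm : ∀ i, k₀ < i → i ≤ k → i ≠ m) : (leftExt u [k]).Subsingleton := by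
  induction k, hle using Nat.le_induction with
  | base => exact h₀
  | succ k hk ih =>
    have ih' := ih fun i hi hi' => hm i hi (by omega)
    intro x hx y hy
    rcases h.mem_leftExt_singleton_succ hx (hm _ (by omega) le_rfl) with ⟨h₁, h₂⟩ | ⟨h₁, x', h₂, h₃⟩
    · rcases h.mem_leftExt_singleton_succ hy (hm _ (by omega) le_rfl) with ⟨h₄, h₅⟩ | ⟨h₄, -⟩
      · rw [h₂, h₅]
      · omega
    · rcases h.mem_leftExt_singleton_succ hy (hm _ (by omega) le_rfl) with ⟨h₄, h₅⟩ | ⟨h₄, y', h₅, h₆⟩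
      · omega
      · rw [← h₃, ← h₆, ih' h₂ h₅]

theorem leftExt_singleton_subsingleton_of_pos {k : ℕ} (hk : k + 1 ≠ m) (ht : 0 < t (k + 1)) :
    (leftExt u [k + 1]).Subsingleton := by
  intro x hx y hy
  rcases h.mem_leftExt_singleton_succ hx hk with ⟨-, h₁⟩ | ⟨h₁, -⟩
  · rcases h.mem_leftExt_singleton_succ hy hk with ⟨-, h₂⟩ | ⟨h₂, -⟩ <;> omega
  · omega

/-- The letters `c` and `d` whose images end in `m`: that of `c` is `0^t m`, that of `d` is
longer. -/
theorem exists_letters : ∃ c d, ((c + 1 = m ∧ d + 1 = m + p) ∨ (c + 1 = m + p ∧ d + 1 = m)) ∧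
    min (t m) (t (m + p)) = t (c + 1) ∧ t (c + 1) < t (d + 1) ∧ c ≠ 0 ∧
    (leftExt u [c]).Subsingleton := by
  have hm := h.m_pos
  have hp := h.p_pos
  rcases h.ne.lt_or_gt with hlt | hlt
  · have hm1 : m ≠ 1 := by
      rintro rfl
      exact hlt.not_ge (h.le _ (by omega))
    refine ⟨m - 1, m + p - 1, Or.inl ⟨by omega, by omega⟩, ?_, ?_, by omega, ?_⟩
    · rw [min_eq_left hlt.le, Nat.sub_add_cancel hm]
    · rwa [Nat.sub_add_cancel hm, Nat.sub_add_cancel (by omega)]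
    · exact h.leftExt_singleton_subsingleton
        (h.leftExt_singleton_subsingleton_of_pos (k := 0) (by omega) h.pos) (by omega)
        fun i _ _ => by omega
  · refine ⟨m + p - 1, m - 1, Or.inr ⟨by omega, by omega⟩, ?_, ?_, by omega, ?_⟩
    · rw [min_eq_right hlt.le, Nat.sub_add_cancel (by omega)]
    · rwa [Nat.sub_add_cancel hm, Nat.sub_add_cancel (by omega)]
    · obtain ⟨i, hi, hi', hpos⟩ := h.exists_pos
      -- If the positive digit is t_{i+1} with i+1 < m+p, the letter i+1 is preceded only by 0. If
      -- it is t_{m+p}, then t_m is positive too and m is preceded only by 0. Uniqueness then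
      -- propagates upwards to m+p-1.
      rcases (show i + 1 ≤ m + p by omega).lt_or_eq with hi'' | hi''
      · exact h.leftExt_singleton_subsingleton
          (h.leftExt_singleton_subsingleton_of_pos (by omega) hpos) (by omega)
          fun i _ _ => by omega
      · rw [hi''] at hpos
        have h0 : ∀ x ∈ leftExt u [m], x = 0 := by
          intro x hx
          by_contra hx0
          obtain ⟨y, d, hy, -, hd, ht⟩ :=
            h.exists_preimage_of_factor (r := 0) (v := []) hx0 hm.ne' hx
          have hdlt : d < m + p := h.lt_of_mem_of_isFactor hy (by simp)
          rcases (nextLetter_eq_iff_m hdlt).1 hd with h' | h' <;> rw [h'] at ht <;> omega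
        exact h.leftExt_singleton_subsingleton (k₀ := m)
          (fun x hx y hy => by rw [h0 x hx, h0 y hy]) (by omega) fun i _ _ => by omega

/-- The word `0^t m` has at most one non-zero left extension. -/
theorem leftExt_seed_unique {x y : ℕ} (hx : x ∈ leftExt u (seed t m p)) (hx0 : x ≠ 0)
    (hy : y ∈ leftExt u (seed t m p)) (hy0 : y ≠ 0) : x = y := by
  obtain ⟨c, d, hcd, hmin, hlt, -, hc⟩ := h.exists_letters
  have key : ∀ x ∈ leftExt u (seed t m p), x ≠ 0 → ∃ x' ∈ leftExt u [c], σ x' = x := by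
    intro x hx hx0
    obtain ⟨x', e, hx', hxx', he, ht⟩ :=
      h.exists_preimage_of_factor (v := []) hx0 h.m_pos.ne' hx
    have helt : e < m + p := h.lt_of_mem_of_isFactor hx' (by simp)
    obtain rfl : e = c := by
      rw [hmin] at ht
      by_contra hne
      have hed : e = d := by
        rcases (nextLetter_eq_iff_m helt).1 he with h' | h' <;> omega
      subst hed
      omega
    exact ⟨x', hx', hxx'⟩
  obtain ⟨x', hx', rfl⟩ := key x hx hx0
  obtain ⟨y', hy', rfl⟩ := key y hy hy0
  rw [hc hx' hy']

/-- The word 0^t m is the full image of the letter c, so the end of the preceding block stands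
before it. -/
theorem exists_mem_leftExt_seed : ∃ z ∈ leftExt u (seed t m p), z ≠ 0 := by
  obtain ⟨c, d, hcd, hmin, hlt, hc, -⟩ := h.exists_letters
  have hp := h.p_pos
  obtain ⟨i, hi⟩ := h.exists_eq_letter (k := c) (by omega)
  obtain ⟨y, hy⟩ := exists_mem_leftExt (t := t) (m := m) (p := p) (v := []) hc ⟨i, by simp [subword, hi]⟩
  refine ⟨σ y, ?_, (nextLetter_pos h.m_pos y).ne'⟩
  have := h.iterate_mem_leftExt hy 1
  rwa [iterSubst_one_singleton, parrySubst, ← hmin, (nextLetter_eq_iff_m (by omega)).2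
    (by omega)] at this

/-! ### Left extensions of the fixed point -/

/-- A zero before u would produce a run of t_1 + 1 zeros, longer than any block allows. -/
theorem pos_of_mem_leftExtInf_fixedWord {b : ℕ} (hb : b ∈ leftExtInf u u) : b ≠ 0 := by
  rintro rfl
  have hz : IsPrefixOf (φ 0) u := by
    have := h.isImage_one 1
    rwa [subword_succ, zero_add, fixedWord_zero,
      show subword u 0 0 ++ [0] = [0] from rfl, iterSubst_one_singleton] at this
  have h₁ := mem_leftExt_of_mem_leftExtInf hb hz
  have h₂ : IsFactor u (List.replicate (t 1 + 1) 0 ++ [σ 0]) := by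
    simpa [leftExt, parrySubst, List.replicate_succ] using h₁
  obtain ⟨d, -, -, hd⟩ := h.exists_block_of_factor (nextLetter_pos h.m_pos 0).ne' h₂
  have := h.le (d + 1) (by omega)
  omega

/-- As u is its own unique preimage, each left extension is σ of another one; being nonzero, they
are pushed up one step at a time until m is reached. -/
theorem le_of_mem_leftExtInf_fixedWord {b : ℕ} (hb : b ∈ leftExtInf u u) : m ≤ b := by
  suffices ∀ n, ∀ b ∈ leftExtInf u u, min n m ≤ b by simpa using this m b hb
  intro n
  induction n with
  | zero => simp
  | succ n ih =>
    intro b hb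
    obtain ⟨a, w, ha, rfl, hw⟩ :=
      h.exists_preimage_of_mem (h.pos_of_mem_leftExtInf_fixedWord hb) hb
    obtain rfl := h.isImage_injective (h.letter_lt_of_mem_leftExtInf ha) h.fixedWord_lt hw
      h.isImage_one
    have := ih a ha
    unfold nextLetter
    split_ifs <;> omega

theorem mem_leftExtInf_fixedWord {b : ℕ} (hb : m ≤ b) (hb' : b < m + p) :
    b ∈ leftExtInf u u := by
  obtain ⟨k, hk, hk', hpos⟩ := h.exists_pos
  have hm := h.m_pos
  obtain ⟨i, hi⟩ := h.exists_eq_letter hk'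
  obtain ⟨y, hy⟩ := exists_mem_leftExt (t := t) (m := m) (p := p) (k := k) (v := []) (by omega)
    ⟨i, by simp [subword, hi]⟩
  have hfac : σ y ∈ leftExt u [0] := by
    refine leftExt_anti ?_ (h.iterate_mem_leftExt hy 1)
    obtain ⟨r, hr⟩ := Nat.exists_eq_succ_of_ne_zero hpos.ne'
    rw [iterSubst_one_singleton, parrySubst, hr]
    exact ⟨List.replicate r 0 ++ [σ k], by simp [List.replicate_succ]⟩
  set a := σ y
  have ha : a < m + p := nextLetter_lt h.p_pos y
  refine mem_leftExtInf_of_frequently fun K => ?_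
  have hp := h.p_pos
  have hbig : a + m + K ≤ p * (a + m + K) := Nat.le_mul_of_pos_left _ hp
  -- The exponent n is at least K, so φ^n(0) covers the prefix; moreover a + n ≥ m and a + n ≡ b mod
  -- p, so σ^n(a) = b.
  refine ⟨iterSubst φ (b + p * (a + m + K) - a) [0], ?_, ?_⟩
  · have h₁ := h.isPrefixOf_iterSubst_zero (b + p * (a + m + K) - a)
    exact (isPrefixOf_subword u K).prefix_of_length_le h₁.2 (by rw [length_subword]; omega)
  · have h₁ := h.iterate_mem_leftExt hfac (b + p * (a + m + K) - a)
    rwa [iterate_nextLetter_eq hp ha hb hb' (by omega)] at h₁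
    rw [show a + (b + p * (a + m + K) - a) = b + p * (a + m + K) by omega]
    simp [Nat.ModEq]

theorem leftExtInf_fixedWord : leftExtInf u u = Set.Ico m (m + p) :=
  Set.ext fun _ => ⟨fun hb => ⟨h.le_of_mem_leftExtInf_fixedWord hb, h.lt_of_mem_leftExtInf hb⟩,
    fun hb => h.mem_leftExtInf_fixedWord hb.1 hb.2⟩

/-! ### Words with arbitrarily deep preimages -/

/-- As long as no zero appears in front, the iterate is the single letter σ^n(k). This letter cycles
through the period and meets one with a positive digit; a leading 0 then persists. -/
theorem zero_prefix_iterSubst {k : ℕ} (hk : k < m + p) :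
    ∃ n, ∀ N, n ≤ N → [0] <+: iterSubst φ N [k] := by
  obtain ⟨i, hi, hi', hpos⟩ := h.exists_pos
  have hp := h.p_pos
  have hstep : ∀ n x, [0] <+: iterSubst φ n [x] → [0] <+: iterSubst φ (n + 1) [x] := by
    intro n x hx
    obtain ⟨s, hs, -⟩ := h.subst_zero_eq
    rw [add_comm, iterSubst_add]
    refine List.IsPrefix.trans ?_ (iterSubst_prefix φ 1 hx)
    rw [iterSubst_one_singleton, hs]
    exact ⟨s, rfl⟩
  have key : ∀ n, [0] <+: iterSubst φ n [k] ∨ iterSubst φ n [k] = [σ^[n] k] := by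
    intro n
    induction n with
    | zero => exact Or.inr rfl
    | succ n ih =>
      rcases ih with ih | ih
      · exact Or.inl (hstep n k ih)
      · rw [add_comm, iterSubst_add, ih, iterSubst_one_singleton, parrySubst,
          Function.iterate_add_apply]
        rcases Nat.eq_zero_or_pos (t (σ^[n] k + 1)) with h0 | h0
        · right
          rw [h0]
          rfl
        · left
          obtain ⟨r, hr⟩ := Nat.exists_eq_succ_of_ne_zero h0.ne'
          rw [hr]
          exact ⟨_, rfl⟩
  have hbig : k + m ≤ p * (k + m) := Nat.le_mul_of_pos_left _ hp
  set n := i + p * (k + m) - k with hn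
  have hfin : [0] <+: iterSubst φ (n + 1) [k] := by
    rcases key n with h' | h'
    · exact hstep n k h'
    · have : σ^[n] k = i := by
        refine iterate_nextLetter_eq hp hk hi hi' (by omega) ?_
        rw [show k + n = i + p * (k + m) by omega]
        simp [Nat.ModEq]
      rw [this] at h'
      rw [add_comm, iterSubst_add, h', iterSubst_one_singleton, parrySubst]
      obtain ⟨r, hr⟩ := Nat.exists_eq_succ_of_ne_zero hpos.ne'
      rw [hr]
      exact ⟨_, rfl⟩
  refine ⟨n + 1, fun N hN => ?_⟩
  induction N, hN using Nat.le_induction with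
  | base => exact hfin
  | succ N _ ih => exact hstep N k ih

theorem eq_fixedWord {w : ℕ → ℕ}
    (hw : ∀ N, ∃ w', (∀ i, w' i < m + p) ∧ IsImage φ N w' w) : w = u := by
  choose f hf using fun k : Fin (m + p) => h.zero_prefix_iterSubst k.2
  funext i
  -- One threshold serves the whole finite alphabet; the further i iterations turn the leading 0
  -- into φ^i(0), a prefix of u containing the letter with index i.
  set J := Finset.univ.sup f with hJ
  obtain ⟨w', hw', hv⟩ := hw (i + J)
  have h₁ : IsPrefixOf (iterSubst φ (i + J) [w' 0]) w := by
    simpa [subword] using hv 1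
  have h₂ := hf ⟨w' 0, hw' 0⟩ J (Finset.le_sup (Finset.mem_univ _))
  rw [iterSubst_add] at h₁
  have h₃ := h₁.of_prefix (iterSubst_prefix φ i h₂)
  obtain ⟨h₄, h₅⟩ := h.isPrefixOf_iterSubst_zero i
  rw [← h₃.getElem h₄, h₅.getElem h₄]

end ParryDigits

end ParryWord

namespace ParryWord

namespace ParryDigits

variable {t : ℕ → ℕ} {m p : ℕ} (h : ParryDigits t m p)

local notation "φ" => parrySubst t m p
local notation "σ" => nextLetter m p
local notation "u" => fixedWord t m p

theorem seed_ne_nil : seed t m p ≠ [] := by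
  simp [seed]

variable (t m p) in
/-- The infinite word `φ^j(0^t m) φ^{m+j}(0^t m) φ^{2m+j}(0^t m) ⋯`. -/
def branch (j : ℕ) : ℕ → ℕ :=
  infConcat 0 fun i => iterSubst φ (i * m + j) (seed t m p)

theorem isImage_branch (i j : ℕ) : IsImage φ i (branch t m p j) (branch t m p (j + i)) := by
  have := isImage_infConcat 0 (subst_ne_nil (t := t) (m := m) (p := p)) i
    (x := fun n => iterSubst φ (n * m + j) (seed t m p)) fun n => iterSubst_ne_nil subst_ne_nil _ seed_ne_nil
  simp only [← iterSubst_add] at this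
  simp only [branch, show ∀ n, n * m + (j + i) = i + (n * m + j) by intro n; omega]
  exact this

/-- Self-similarity: `branch 0` equals 0^t m followed by its own image under φ^m, here on finite
prefixes. -/
theorem flatMap_seed_succ (n : ℕ) :
    ((List.range (n + 1)).flatMap fun i => iterSubst φ (i * m + 0) (seed t m p)) =
      seed t m p ++ iterSubst φ m
        ((List.range n).flatMap fun i => iterSubst φ (i * m + 0) (seed t m p)) := by
  rw [List.range_succ_eq_map, List.flatMap_cons, iterSubst_flatMap, List.flatMap_map]
  congr 1
  · simp [iterSubst]
  · congr 1
    funext i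
    rw [← iterSubst_add, Nat.succ_mul]
    congr 1
    omega

include h

/-! ### Left special branches with the left extension `0` -/

/-- The nonzero extension makes the word start with a whole block φ(c); the extension 0 puts φ(c) at
the end of a longer block φ(d). This forces {c, d} = {m-1, m+p-1}, and both letters precede the
preimage of what follows. -/
theorem zero_mem_leftExtInf {w : ℕ → ℕ} {b : ℕ} (h0 : 0 ∈ leftExtInf u w)
    (hb : b ∈ leftExtInf u w) (hb0 : b ≠ 0) :
    IsPrefixOf (seed t m p) w ∧ ∃ y, IsImage φ 1 y (shiftWord (seed t m p).length w) ∧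
      ∀ x, x + 1 = m ∨ x + 1 = m + p → x ∈ leftExtInf u y := by
  obtain ⟨b', y, hb', -, hy⟩ := h.exists_preimage_of_mem hb0 hb
  have hylt := h.letter_lt_of_mem_leftExtInf hb'
  set c := y 0 with hc
  have hcw : IsPrefixOf (φ c) w := by
    simpa [subword_succ, subword, iterSubst, applySubst, hc] using hy 1
  have hfac : IsFactor u (List.replicate (t (c + 1) + 1) 0 ++ [σ c]) := by
    simpa [leftExt, parrySubst, List.replicate_succ] using mem_leftExt_of_mem_leftExtInf h0 hcw
  obtain ⟨d, hd, hdc, hlt⟩ := h.exists_block_of_factor (nextLetter_pos h.m_pos c).ne' hfac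
  obtain ⟨hσ, hcd⟩ := (nextLetter_eq_nextLetter (hylt 0) hd hdc.symm).resolve_left
    (fun e => by
      obtain rfl : d = c := e.symm
      omega)
  have hseed : φ c = seed t m p := by
    have hmin : t (c + 1) = min (t m) (t (m + p)) := by
      rcases hcd with h' | h' <;> rw [h'.1, h'.2] at hlt <;> rw [h'.1] <;> omega
    rw [parrySubst, seed, hσ, hmin]
  have hsh : IsImage φ 1 (shiftWord 1 y) (shiftWord (seed t m p).length w) := by
    have := hy.shiftWord 1
    rwa [subword_succ, show subword y 0 0 ++ [y (0 + 0)] = [c] from rfl, iterSubst_one_singleton,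
      hseed] at this
  refine ⟨hseed ▸ hcw, shiftWord 1 y, hsh, ?_⟩
  have hcmem : c ∈ leftExtInf u (shiftWord 1 y) := mem_leftExtInf.2 fun n => by
    have := mem_leftExtInf.1 hb' (n + 1)
    rw [subword_succ'] at this
    rw [subword_shiftWord, add_zero]
    exact IsFactor.of_infix this (List.suffix_cons _ _).isInfix
  -- Desubstitution after the longer run 0·0^t m: the letter found has more zeros than c, hence is
  -- the other letter d.
  obtain ⟨e, y', he, hem, hlt', hy'⟩ := h.exists_preimage (r := t (c + 1) + 1) h.m_pos.ne'
    (w := shiftWord (seed t m p).length w) fun n => by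
      have := mem_leftExt_of_mem_leftExtInf h0
        (isPrefixOf_append.2 ⟨hseed ▸ hcw, isPrefixOf_subword _ n⟩)
      rw [← hseed, parrySubst, hσ] at this ⊢
      simpa [leftExt, List.replicate_succ] using this
  obtain rfl := h.isImage_injective (h.letter_lt_of_mem_leftExtInf he) (fun i => hylt _) hy' hsh
  obtain rfl : e = d := by
    have helt := h.lt_of_mem_leftExtInf he
    have hne : e ≠ c := by rintro rfl; omega
    have := (nextLetter_eq_iff_m helt).1 hem
    omega
  intro x hx
  have : x = c ∨ x = e := by omega
  rcases this with rfl | rfl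
  exacts [hcmem, he]

/-- Both extensions are pulled back j times. Below m the map σ has no second preimage, so j descends
to 0, while the other letter stays larger and keeps the congruence. -/
theorem exists_preimage_of_modEq {j b : ℕ} {w : ℕ → ℕ} (hj : j < m) (hjw : j ∈ leftExtInf u w)
    (hbw : b ∈ leftExtInf u w) (hjb : j < b) (hmod : b ≡ j [MOD p]) :
    ∃ w' x, IsImage φ j w' w ∧ 0 ∈ leftExtInf u w' ∧ x ∈ leftExtInf u w' ∧ x ≠ 0 ∧ p ∣ x := by
  induction j generalizing b w with
  | zero => exact ⟨w, b, isImage_zero w, hjw, hbw, hjb.ne', (Nat.modEq_zero_iff_dvd).1 hmod⟩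
  | succ j ih =>
    obtain ⟨a, w₁, ha, haj, hw₁⟩ := h.exists_preimage_of_mem (Nat.succ_ne_zero j) hjw
    obtain ⟨c, w₂, hc, hcb, hw₂⟩ := h.exists_preimage_of_mem (by omega) hbw
    obtain rfl := h.isImage_injective (h.letter_lt_of_mem_leftExtInf ha)
      (h.letter_lt_of_mem_leftExtInf hc) hw₁ hw₂
    have hclt := h.lt_of_mem_leftExtInf hc
    obtain rfl : a = j := by
      have := nextLetter_eq_of_ne (h.lt_of_mem_leftExtInf ha) hj.ne haj
      omega
    have hac : a < c := by
      unfold nextLetter at hcb; split_ifs at hcb <;> omega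
    obtain ⟨w', x, hw', hrest⟩ := ih (by omega) ha hc hac
      (Nat.ModEq.add_right_cancel' 1 ((nextLetter_modEq hclt).symm.trans (hcb ▸ hmod)))
    exact ⟨w', x, hw'.trans hw₁, hrest⟩

theorem exists_preimage_after_seed {w : ℕ → ℕ} {z : ℕ} (h0 : 0 ∈ leftExtInf u w)
    (hz : z ∈ leftExtInf u w) (hz0 : z ≠ 0) :
    p ∣ z ∧ ∃ w', 0 ∈ leftExtInf u w' ∧ z ∈ leftExtInf u w' ∧
      IsImage φ m w' (shiftWord (seed t m p).length w) := by
  have hm := h.m_pos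
  have hp := h.p_pos
  obtain ⟨hseed, y, hy, hmem⟩ := h.zero_mem_leftExtInf h0 hz hz0
  obtain ⟨w', x, hw', h0', hx, hx0, hpx⟩ := h.exists_preimage_of_modEq (j := m - 1)
    (b := m + p - 1) (by omega) (hmem _ (by omega)) (hmem _ (by omega)) (by omega)
    (by rw [show m + p - 1 = m - 1 + p by omega]; simp [Nat.ModEq])
  have hxz : x = z := h.leftExt_seed_unique
    (mem_leftExt_of_mem_leftExtInf hx (h.zero_mem_leftExtInf h0' hx hx0).1) hx0
    (mem_leftExt_of_mem_leftExtInf hz hseed) hz0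
  subst hxz
  have himg := hw'.trans hy
  rw [Nat.sub_add_cancel hm] at himg
  exact ⟨hpx, w', h0', hx, himg⟩

theorem eq_branch_zero {w : ℕ → ℕ} {z : ℕ} (h0 : 0 ∈ leftExtInf u w)
    (hz : z ∈ leftExtInf u w) (hz0 : z ≠ 0) : w = branch t m p 0 := by
  refine eq_infConcat 0 (fun i => iterSubst_ne_nil subst_ne_nil _ seed_ne_nil) fun n => ?_
  induction n generalizing w with
  | zero => simp [IsPrefixOf, subword]
  | succ n ih =>
    obtain ⟨-, w', h0', hz', hw'⟩ := h.exists_preimage_after_seed h0 hz hz0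
    rw [flatMap_seed_succ, isPrefixOf_append]
    exact ⟨(h.zero_mem_leftExtInf h0 hz hz0).1, hw'.isPrefixOf (ih h0' hz')⟩

/-- The integer N bounds the number of desubstitutions; they stop earlier only when one of the two
extensions is 0. -/
theorem exists_preimage_zero_or_deep (N : ℕ) {w : ℕ → ℕ} {a b : ℕ} (hab : a ≠ b)
    (ha : a ∈ leftExtInf u w) (hb : b ∈ leftExtInf u w) :
    (∃ n w' z, z ≠ 0 ∧ 0 ∈ leftExtInf u w' ∧ z ∈ leftExtInf u w' ∧ IsImage φ n w' w ∧
      ((σ^[n] 0 = a ∧ σ^[n] z = b) ∨ (σ^[n] 0 = b ∧ σ^[n] z = a))) ∨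
    ∃ w', (∀ i, w' i < m + p) ∧ IsImage φ N w' w := by
  induction N generalizing w a b with
  | zero => exact Or.inr ⟨w, h.letter_lt_of_mem_leftExtInf ha, isImage_zero w⟩
  | succ N ih =>
    rcases eq_or_ne a 0 with rfl | ha0
    · exact Or.inl ⟨0, w, b, hab.symm, ha, hb, isImage_zero w, Or.inl ⟨rfl, rfl⟩⟩
    rcases eq_or_ne b 0 with rfl | hb0
    · exact Or.inl ⟨0, w, a, hab, hb, ha, isImage_zero w, Or.inr ⟨rfl, rfl⟩⟩
    obtain ⟨a', w₁, ha', rfl, hw₁⟩ := h.exists_preimage_of_mem ha0 ha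
    obtain ⟨b', w₂, hb', rfl, hw₂⟩ := h.exists_preimage_of_mem hb0 hb
    obtain rfl := h.isImage_injective (h.letter_lt_of_mem_leftExtInf ha')
      (h.letter_lt_of_mem_leftExtInf hb') hw₁ hw₂
    rcases ih (fun e => hab (congrArg σ e)) ha' hb' with
      ⟨n, w', z, hz, h0w, hzw, himg, hor⟩ | ⟨w', hw', himg⟩
    · refine Or.inl ⟨n + 1, w', z, hz, h0w, hzw, himg.trans hw₁, ?_⟩
      simp only [Function.iterate_succ_apply']
      rcases hor with ⟨h₁, h₂⟩ | ⟨h₁, h₂⟩ <;> simp [h₁, h₂]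
    · exact Or.inr ⟨w', hw', himg.trans hw₁⟩

/-- Every infinite left special branch is the fixed point or one of the words `branch j`. -/
theorem eq_fixedWord_or_eq_branch {w : ℕ → ℕ} (hw : (leftExtInf u w).Nontrivial) :
    w = u ∨ ((∃ z ∈ leftExt u (seed t m p), z ≠ 0 ∧ p ∣ z) ∧ ∃ j < m, w = branch t m p j) := by
  obtain ⟨a, ha, b, hb, hab⟩ := hw
  by_cases hdeep : ∀ N, ∃ w', (∀ i, w' i < m + p) ∧ IsImage φ N w' w
  · exact Or.inl (h.eq_fixedWord hdeep)
  · push Not at hdeep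
    obtain ⟨N, hN⟩ := hdeep
    rcases h.exists_preimage_zero_or_deep N hab ha hb with
      ⟨n, w', z, hz, h0w, hzw, himg, hor⟩ | ⟨w', hw', himg⟩
    · obtain ⟨hpz, -⟩ := h.exists_preimage_after_seed h0w hzw hz
      have hseed := (h.zero_mem_leftExtInf h0w hzw hz).1
      refine Or.inr ⟨⟨z, mem_leftExt_of_mem_leftExtInf hzw hseed, hz, hpz⟩, n, ?_, ?_⟩
      -- For n ≥ m both iterates lie in the periodic range with equal residues, since p divides z;
      -- then a and b would coincide.
      · by_contra! hmn
        have hp := h.p_pos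
        have hpos : 0 < m + p := by omega
        have heq : σ^[n] z = σ^[n] 0 := by
          refine iterate_nextLetter_eq hp (h.lt_of_mem_leftExtInf hzw)
            (le_iterate_nextLetter hp (by omega)) (iterate_nextLetter_lt hp hpos n) (by omega) ?_
          refine Nat.ModEq.trans ?_ (iterate_nextLetter_modEq hp hpos n).symm
          exact ((Nat.modEq_zero_iff_dvd).2 hpz).add_right n
        rcases hor with ⟨h₁, h₂⟩ | ⟨h₁, h₂⟩ <;> exact hab (by rw [← h₁, ← h₂, heq])
      · obtain rfl := h.eq_branch_zero h0w hzw hz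
        have := isImage_branch (t := t) (m := m) (p := p) n 0
        rw [zero_add] at this
        exact himg.unique subst_ne_nil this
    · exact absurd himg (hN w' hw')

/-! ### The left special branches different from the fixed point -/

theorem mem_leftExt_append_seed {v : List ℕ} {z : ℕ} (hz : z ∈ leftExt u (seed t m p))
    (hz0 : z ≠ 0) (hpz : p ∣ z) (h0v : 0 ∈ leftExt u v) (hzv : z ∈ leftExt u v) :
    0 ∈ leftExt u (seed t m p ++ iterSubst φ m v) ∧
      z ∈ leftExt u (seed t m p ++ iterSubst φ m v) := by
  obtain ⟨c, d, hcd, hmin, hlt, hc, -⟩ := h.exists_letters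
  have hm := h.m_pos
  have hp := h.p_pos
  have hzlt : z < m + p := h.lt_of_mem_of_isFactor hz (by simp)
  have hple : p ≤ z := Nat.le_of_dvd (by omega) hpz
  have hmem : ∀ x, x + 1 = m ∨ x + 1 = m + p → x ∈ leftExt u (iterSubst φ (m - 1) v) := by
    rintro x (hx | hx)
    · have := h.iterate_mem_leftExt h0v (m - 1)
      rwa [iterate_nextLetter_of_lt (by omega), show 0 + (m - 1) = x by omega] at this
    · have := h.iterate_mem_leftExt hzv (m - 1)
      rwa [iterate_nextLetter_eq (b := x) hp hzlt (by omega) (by omega) (by omega)] at this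
      rw [show x = p + (m - 1) by omega]
      refine Nat.ModEq.add_right _ (((Nat.modEq_zero_iff_dvd).2 hpz).trans ?_)
      simp [Nat.ModEq]
  have himg : ∀ x, σ x = m → iterSubst φ 1 (x :: iterSubst φ (m - 1) v) =
      List.replicate (t (x + 1)) 0 ++ [m] ++ iterSubst φ m v := by
    intro x hx
    rw [← List.singleton_append, iterSubst_append, iterSubst_one_singleton, parrySubst, hx,
      ← iterSubst_add, show 1 + (m - 1) = m by omega]
  have hcm : σ c = m := (nextLetter_eq_iff_m (by omega)).2 (by omega)
  have hdm : σ d = m := (nextLetter_eq_iff_m (by omega)).2 (by omega)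
  constructor
  · have h₁ : IsFactor u (iterSubst φ 1 (d :: iterSubst φ (m - 1) v)) :=
      isFactor_iterSubst (h.isImage_self 1) (hmem d (by omega))
    rw [himg d hdm] at h₁
    -- The surplus zeros of φ(d) put a 0 in front of 0^t m.
    refine h₁.of_infix ⟨List.replicate (t (d + 1) - (t (c + 1) + 1)) 0, [], ?_⟩
    rw [seed, hmin, show t (d + 1) = t (d + 1) - (t (c + 1) + 1) + (t (c + 1) + 1) by omega,
      List.replicate_add (t (d + 1) - (t (c + 1) + 1))]
    simp [List.replicate_succ]
  · obtain ⟨y, hy⟩ := exists_mem_leftExt hc (hmem c (by omega))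
    have h₁ := h.iterate_mem_leftExt hy 1
    rw [himg c hcm, ← hmin] at h₁
    have h₂ : σ y = z := h.leftExt_seed_unique (leftExt_anti (List.prefix_append _ _) h₁)
      (nextLetter_pos h.m_pos y).ne' hz hz0
    rw [← h₂]
    exact h₁

theorem mem_leftExtInf_branch_zero {z : ℕ} (hz : z ∈ leftExt u (seed t m p)) (hz0 : z ≠ 0)
    (hpz : p ∣ z) : 0 ∈ leftExtInf u (branch t m p 0) ∧ z ∈ leftExtInf u (branch t m p 0) := by
  have key : ∀ n,
      0 ∈ leftExt u ((List.range n).flatMap fun i => iterSubst φ (i * m + 0) (seed t m p)) ∧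
      z ∈ leftExt u ((List.range n).flatMap fun i => iterSubst φ (i * m + 0) (seed t m p)) := by
    intro n
    induction n with
    | zero =>
      refine ⟨⟨0, by simp [subword, fixedWord_zero]⟩, ?_⟩
      exact leftExt_anti List.nil_prefix hz
    | succ n ih =>
      rw [flatMap_seed_succ]
      exact h.mem_leftExt_append_seed hz hz0 hpz ih.1 ih.2
  have hpre := fun n => subword_infConcat_prefix 0
    (x := fun i => iterSubst φ (i * m + 0) (seed t m p))
    (fun i => iterSubst_ne_nil subst_ne_nil _ seed_ne_nil) n
  exact ⟨mem_leftExtInf_of_frequently fun n => ⟨_, hpre n, (key n).1⟩,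
    mem_leftExtInf_of_frequently fun n => ⟨_, hpre n, (key n).2⟩⟩

theorem mem_leftExtInf_branch {z j : ℕ} (hz : z ∈ leftExt u (seed t m p)) (hz0 : z ≠ 0)
    (hpz : p ∣ z) (hj : j < m) :
    j ∈ leftExtInf u (branch t m p j) ∧ σ^[j] z ∈ leftExtInf u (branch t m p j) ∧
      σ^[j] z ≠ j ∧ σ^[j] z ≠ 0 := by
  obtain ⟨h₁, h₂⟩ := h.mem_leftExtInf_branch_zero hz hz0 hpz
  have himg := isImage_branch (t := t) (m := m) (p := p) j 0
  rw [zero_add] at himg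
  have h₃ := h.iterate_mem_leftExtInf h₁ himg
  rw [iterate_nextLetter_of_lt (by omega), zero_add] at h₃
  refine ⟨h₃, h.iterate_mem_leftExtInf h₂ himg, ?_⟩
  rcases lt_or_ge (z + j) (m + p) with hlt | hge
  · rw [iterate_nextLetter_of_lt hlt]; omega
  · have := le_iterate_nextLetter h.p_pos (show m ≤ z + j by omega)
    omega

theorem isInfLSBranch_branch {z j : ℕ} (hz : z ∈ leftExt u (seed t m p)) (hz0 : z ≠ 0)
    (hpz : p ∣ z) (hj : j < m) : (leftExtInf u (branch t m p j)).Nontrivial :=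
  have h₁ := h.mem_leftExtInf_branch hz hz0 hpz hj
  ⟨_, h₁.1, _, h₁.2.1, h₁.2.2.1.symm⟩

theorem branch_ne_fixedWord {z j : ℕ} (hz : z ∈ leftExt u (seed t m p)) (hz0 : z ≠ 0)
    (hpz : p ∣ z) (hj : j < m) : branch t m p j ≠ u := by
  intro heq
  have h₁ := (h.mem_leftExtInf_branch hz hz0 hpz hj).1
  rw [heq] at h₁
  exact (h.le_of_mem_leftExtInf_fixedWord h₁).not_gt hj

/-- Pulling back i times reduces to i = 0. There the branch would start with 0^t m and have two
distinct nonzero left extensions, j and σ^j(z). -/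
theorem not_mem_leftExtInf_branch {z i j : ℕ} (hz : z ∈ leftExt u (seed t m p)) (hz0 : z ≠ 0)
    (hpz : p ∣ z) (hij : i < j) (hj : j < m) : i ∉ leftExtInf u (branch t m p j) := by
  induction i generalizing j with
  | zero =>
    intro h0
    obtain ⟨h₁, h₂, hne, hne'⟩ := h.mem_leftExtInf_branch hz hz0 hpz hj
    have hseed := (h.zero_mem_leftExtInf h0 h₁ hij.ne').1
    exact hne (h.leftExt_seed_unique (mem_leftExt_of_mem_leftExtInf h₂ hseed) hne'
      (mem_leftExt_of_mem_leftExtInf h₁ hseed) hij.ne')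
  | succ i ih =>
    intro hi
    obtain ⟨k, rfl⟩ : ∃ k, j = k + 1 := Nat.exists_eq_succ_of_ne_zero (by omega)
    obtain ⟨a, w, ha, hai, hw⟩ := h.exists_preimage_of_mem (Nat.succ_ne_zero i) hi
    obtain rfl := h.isImage_injective (h.letter_lt_of_mem_leftExtInf ha)
      (h.letter_lt_of_mem_leftExtInf
        (h.mem_leftExtInf_branch hz hz0 hpz (show k < m by omega)).1) hw (isImage_branch 1 k)
    obtain rfl : a = i := by
      have := nextLetter_eq_of_ne (h.lt_of_mem_leftExtInf ha) (by omega) hai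
      omega
    exact ih (by omega) (by omega) ha

theorem branch_injOn {z : ℕ} (hz : z ∈ leftExt u (seed t m p)) (hz0 : z ≠ 0) (hpz : p ∣ z) :
    Set.InjOn (branch t m p) (Set.Iio m) := by
  have key : ∀ i j, i < j → j < m → branch t m p i ≠ branch t m p j := by
    intro i j hij hj heq
    have h₁ := (h.mem_leftExtInf_branch hz hz0 hpz (hij.trans hj)).1
    rw [heq] at h₁
    exact h.not_mem_leftExtInf_branch hz hz0 hpz hij hj h₁
  intro i hi j hj heq
  by_contra hne
  rcases lt_or_gt_of_ne hne with h' | h'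
  · exact key i j h' hj heq
  · exact key j i h' hi heq.symm

theorem isInfLSBranch_iff (w : ℕ → ℕ) : IsInfLSBranch u w ↔ (leftExtInf u w).Nontrivial :=
  ParryWord.isInfLSBranch_iff fun i => (h.fixedWord_lt i).le

theorem nontrivial_leftExtInf_fixedWord_iff : (leftExtInf u u).Nontrivial ↔ 1 < p := by
  rw [h.leftExtInf_fixedWord]
  constructor
  · rintro ⟨a, ha, b, hb, hab⟩
    rw [Set.mem_Ico] at ha hb
    omega
  · exact fun hp => ⟨m, ⟨le_rfl, by omega⟩, m + 1, ⟨by omega, by omega⟩, by omega⟩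

end ParryDigits

/-! ### The digits of the Rényi expansion of unity -/

section Digits

variable {β : ℝ}

theorem renyiDigit_succ (β : ℝ) (k : ℕ) :
    renyiDigit β (k + 1) = ⌊β * (betaMap β)^[k] 1⌋₊ := rfl

theorem iterate_betaMap_mem (β : ℝ) (k : ℕ) :
    0 ≤ (betaMap β)^[k] 1 ∧ (betaMap β)^[k] 1 ≤ 1 := by
  cases k with
  | zero => simp
  | succ k =>
    rw [Function.iterate_succ_apply']
    exact ⟨Int.fract_nonneg _, (Int.fract_lt_one _).le⟩

theorem iterate_betaMap_succ (hβ : 1 < β) (k : ℕ) :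
    (betaMap β)^[k + 1] 1 = β * (betaMap β)^[k] 1 - renyiDigit β (k + 1) := by
  have h0 : 0 ≤ β * (betaMap β)^[k] 1 :=
    mul_nonneg (by linarith) (iterate_betaMap_mem β k).1
  rw [Function.iterate_succ_apply', renyiDigit_succ, betaMap, Int.fract,
    natCast_floor_eq_intCast_floor h0]

/-- With equal digits the difference of the two orbits is multiplied by β at each step, yet stays
bounded by 1. -/
theorem iterate_betaMap_eq (hβ : 1 < β) {a b : ℕ}
    (h : ∀ k, renyiDigit β (a + k + 1) = renyiDigit β (b + k + 1)) :
    (betaMap β)^[a] 1 = (betaMap β)^[b] 1 := by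
  have key : ∀ k, (betaMap β)^[a + k] 1 - (betaMap β)^[b + k] 1 =
      β ^ k * ((betaMap β)^[a] 1 - (betaMap β)^[b] 1) := by
    intro k
    induction k with
    | zero => simp
    | succ k ih =>
      rw [← add_assoc, ← add_assoc, iterate_betaMap_succ hβ, iterate_betaMap_succ hβ, h k, pow_succ',
        mul_assoc, ← ih]
      ring
  by_contra hne
  have hpos : 0 < |(betaMap β)^[a] 1 - (betaMap β)^[b] 1| := abs_pos.2 (sub_ne_zero.2 hne)
  obtain ⟨k, hk⟩ := pow_unbounded_of_one_lt (1 / |(betaMap β)^[a] 1 - (betaMap β)^[b] 1|) hβ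
  rw [div_lt_iff₀ hpos] at hk
  have h₁ := iterate_betaMap_mem β (a + k)
  have h₂ := iterate_betaMap_mem β (b + k)
  have h₃ : |(betaMap β)^[a + k] 1 - (betaMap β)^[b + k] 1| ≤ 1 :=
    abs_le.2 ⟨by linarith, by linarith⟩
  rw [key, abs_mul, abs_of_nonneg (pow_nonneg (by linarith) k)] at h₃
  linarith

/-- The two minima are taken separately. The least period, valid far out, is carried back to the
least preperiod by shifting the index by a multiple of a period valid there. -/
theorem hasPreperiodPeriod (hβ : ∃ m p, HasPreperiodPeriod β m p) :
    HasPreperiodPeriod β (preperiod β) (period β) := by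
  obtain ⟨m, p, h⟩ := hβ
  obtain ⟨q, hm, hq, hmq⟩ : preperiod β ∈ {m | ∃ p, HasPreperiodPeriod β m p} :=
    Nat.sInf_mem ⟨m, p, h⟩
  obtain ⟨n, -, hp, hnp⟩ : period β ∈ {p | ∃ m, HasPreperiodPeriod β m p} :=
    Nat.sInf_mem ⟨p, m, h⟩
  have hmul : ∀ N i, preperiod β < i → renyiDigit β (i + N * q) = renyiDigit β i := by
    intro N i hi
    induction N with
    | zero => simp
    | succ N ih => rw [add_mul, one_mul, ← add_assoc, hmq _ (by omega), ih]
  refine ⟨hm, hp, fun i hi => ?_⟩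
  have hn : n ≤ n * q := Nat.le_mul_of_pos_right n hq
  rw [← hmul n _ (by omega), ← hmul n i hi, add_right_comm, hnp _ (by omega)]

theorem renyiDigit_preperiod_ne (hβ : IsNonSimpleParry β) :
    renyiDigit β (preperiod β) ≠ renyiDigit β (preperiod β + period β) := by
  obtain ⟨hm, hp, hper⟩ := hasPreperiodPeriod hβ.2.1
  intro heq
  have hper' : ∀ i, preperiod β ≤ i → renyiDigit β (i + period β) = renyiDigit β i := by
    intro i hi
    rcases hi.lt_or_eq with hi | rfl
    exacts [hper i hi, heq.symm]
  rcases Nat.lt_or_ge 1 (preperiod β) with h1 | h1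
  · have : preperiod β ≤ preperiod β - 1 :=
      Nat.sInf_le ⟨period β, by omega, hp, fun i hi => hper' i (by omega)⟩
    omega
  -- With preperiod 1 the expansion would be purely periodic, making 1 equal to a later point of its
  -- orbit, which is a fractional part.
  · have h₁ := iterate_betaMap_eq hβ.1 (a := 0) (b := period β) fun k => by
      rw [zero_add, ← hper' (k + 1) (by omega)]
      congr 1
      omega
    obtain ⟨k, hk⟩ := Nat.exists_eq_succ_of_ne_zero hp.ne'
    rw [hk, Function.iterate_succ_apply'] at h₁
    exact (Int.fract_lt_one (β * (betaMap β)^[k] 1)).ne h₁.symm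

theorem IsNonSimpleParry.parryDigits (hβ : IsNonSimpleParry β) :
    ParryDigits (renyiDigit β) (preperiod β) (period β) := by
  obtain ⟨hm, hp, hper⟩ := hasPreperiodPeriod hβ.2.1
  refine ⟨hm, hp, renyiDigit_preperiod_ne hβ, fun i hi => ?_, ?_, ?_⟩
  · obtain ⟨k, rfl⟩ := Nat.exists_eq_succ_of_ne_zero hi.ne'
    exact Nat.floor_mono (mul_le_mul_of_nonneg_left (iterate_betaMap_mem β k).2
      (by linarith [hβ.1]))
  · rw [← zero_add 1, renyiDigit_succ, Nat.floor_pos]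
    simpa using hβ.1.le
  · by_contra! hzero
    refine hβ.2.2 ⟨preperiod β, fun i hi => ?_⟩
    induction i using Nat.strong_induction_on with
    | _ i ih =>
      rcases le_or_gt i (preperiod β + period β) with hle | hlt
      · have := hzero (i - 1) (by omega) (by omega)
        rw [Nat.sub_add_cancel (by omega)] at this
        omega
      · rw [← ih (i - period β) (by omega) (by omega), ← hper (i - period β) (by omega)]
        congr 1
        omega

end Digits

end ParryWord

/-! ### The main theorem -/

open ParryWord
theorem mainTheorem4 (β : ℝ) (hβ : IsNonSimpleParry β) :
    (1 < period β →
      IsInfLSBranch (parryWord β) (parryWord β) ∧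
      leftExtInf (parryWord β) (parryWord β) =
        Set.Ico (preperiod β) (preperiod β + period β)) ∧
    (β ∉ setS → ∀ w : ℕ → ℕ, IsInfLSBranch (parryWord β) w ↔ w = parryWord β) ∧
    (β ∈ setS →
      (∀ j < preperiod β, IsInfLSBranch (parryWord β) (branchWord β j)) ∧
      Set.InjOn (branchWord β) (Set.Iio (preperiod β)) ∧
      (∀ j < preperiod β, branchWord β j ≠ parryWord β) ∧
      ∀ w : ℕ → ℕ, IsInfLSBranch (parryWord β) w →
        (1 < period β ∧ w = parryWord β) ∨ ∃ j < preperiod β, w = branchWord β j) := by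
  have h := hβ.parryDigits
  have hu : parryWord β = ParryDigits.fixedWord (renyiDigit β) (preperiod β) (period β) := rfl
  have hs : seedWord β = ParryDigits.seed (renyiDigit β) (preperiod β) (period β) := rfl
  have hb : branchWord β = ParryDigits.branch (renyiDigit β) (preperiod β) (period β) := rfl
  have hdvd : ∀ z, z ≠ 0 → period β ∣ z → ∃ s, 0 < s ∧ z = s * period β := by
    rintro _ hz ⟨s, rfl⟩
    exact ⟨s, Nat.pos_of_ne_zero (by rintro rfl; simp at hz), mul_comm _ _⟩
  simp only [setS, Set.mem_ofPred_eq, hu, hs, hb, h.isInfLSBranch_iff]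
  refine ⟨fun hp => ⟨h.nontrivial_leftExtInf_fixedWord_iff.2 hp, h.leftExtInf_fixedWord⟩,
    fun hS w => ⟨fun hw => ?_, ?_⟩, ?_⟩
  · refine (h.eq_fixedWord_or_eq_branch hw).resolve_right ?_
    rintro ⟨⟨z, hz, hz0, hpz⟩, -⟩
    exact hS ⟨hβ, z, hz, hz0, hdvd z hz0 hpz⟩
  · rintro rfl
    rw [h.nontrivial_leftExtInf_fixedWord_iff]
    -- For p = 1 every nonzero z is a multiple of p, so β would lie in 𝒮.
    by_contra hp
    have hp1 : period β = 1 := by have := h.p_pos; omega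
    obtain ⟨z, hz, hz0⟩ := h.exists_mem_leftExt_seed
    exact hS ⟨hβ, z, hz, hz0, hdvd z hz0 (by rw [hp1]; exact one_dvd z)⟩
  · rintro ⟨-, z, hz, hz0, s, -, hzs⟩
    have hpz : period β ∣ z := ⟨s, by rw [hzs, mul_comm]⟩
    refine ⟨fun j hj => h.isInfLSBranch_branch hz hz0 hpz hj, h.branch_injOn hz hz0 hpz,
      fun j hj => h.branch_ne_fixedWord hz hz0 hpz hj, fun w hw => ?_⟩
    rcases h.eq_fixedWord_or_eq_branch hw with rfl | ⟨-, hj⟩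
    · exact Or.inl ⟨h.nontrivial_leftExtInf_fixedWord_iff.1 hw, rfl⟩
    · exact Or.inr hj
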